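/- Smoothness is in the sense of Bastiani: a continuous map $f\colon E\supseteq U\to F$ on an open subset of a Hausdorff locally convex space is $C^{n}$, $n\ge 1$, if all directional derivatives $df(x;v)=\lim_{t\to0}t^{-1}(f(x+tv)-f(x))$ exist and $df\colon U\times E\to F$ is $C^{n-1}$; it is smooth if it is $C^n$ for all $n$. Let $M$ be a smooth manifold modelled on a real Hausdorff locally convex space $E$, and let $g$ be a weak Riemannian metric on $M$, i.e. a smooth map $g\colon TM\oplus TM\to\mathbb R$ whose restriction $g_p$ to each $T_pM$ is an inner product (it need not induce the topology of $T_pM$). In a chart with domain $U$ write $g_U(x,v,w)$ for the local representative of $g$ and $d_1$ for the derivative in the first variable. A covariant derivative $\nabla$ on $M$ is a family of operators $\nabla\colon\mathcal V(U)\times\mathcal V(U)\to\mathcal V(U)$, $U\subseteq M$ open, compatible with restriction to smaller open sets, additive in both arguments, with $\nabla_{fX}Y=f\nabla_XY$ and $\nabla_X(fY)=(X.f)Y+f\nabla_XY$ for $f\in C^\infty(U,\mathbb R)$. It is a metric derivative (Levi-Civita derivative) of $g$ if in addition $\nabla_XY-\nabla_YX=[X,Y]$ and $X.g(Y,Z)=g(\nabla_XY,Z)+g(Y,\nabla_XZ)$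 for all smooth vector fields $X,Y,Z$ on open sets; if $E$ is not a Fréchet space, it is also required to take smooth families of vector fields (with parameter in $E$) to smooth families. The metric $g$ is called robust if (1) the Hilbert space completions $\overline{T_xM}^{g_x}$ of the tangent spaces form a smooth vector bundle $\overline{TM}=\bigcup_{x\in M}\overline{T_xM}^{g_x}$ over $M$ whose trivialisations extend bundle trivialisations of $TM$; that is, around every point of $M$ there are an open set $W$, a smooth bundle trivialisation $\theta\colon TW\to W\times E$, a Hilbert space $H$, a continuous linear map $j\colon E\to H$ and isomorphisms of topological vector spaces $\bar\theta_x\colon\overline{T_xM}^{g_x}\to H$, $x\in W$, with $\bar\theta_x|_{T_xM}=j\circ\theta_x$, such that for any two of these the changes of trivialisation $(x,h)\mapsto\bar\theta'_x\bar\theta_x^{-1}h$ are smooth on $(W\cap W')\times H$; and (2) a metric derivative of $g$ exists. A spray on $M$ is a smooth vector field $S\colon TM\to T(TM)$ with $T\pi_M\circ S=\mathrm{id}_{TM}$ and $S\circ h_\lambda=Th_\lambda(\lambda S)$ for all $\lambda\in\mathbb R$, where $h_\lambda\colon TM\to TM$ is multiplication by $\lambda$ in the fibres; in a chart it has the form $S_U(x,v)=(x,v,v,\Gamma_U(x,v))$.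 It is a metric spray of $g$ if in every chart $$g_U(x,\Gamma_U(x,v),w)=\tfrac12\,d_1g_U(x,v,v;w)-d_1g_U(x,v,w;v)$$ for all $x$, $v$, $w$. The pair $(M,g)$ is a Hesse manifold if $g$ admits a metric spray. **Proposition.** If $g$ is a robust Riemannian metric on $M$, then $(M,g)$ is a Hesse manifold. -/

import Mathlib

open Set Filter Topology TopologicalSpace

universe u v w

noncomputable section

/-! ### Bastiani calculus on locally convex spaces -/

section Calculus

variable {E : Type u} [AddCommGroup E] [Module ℝ E] [TopologicalSpace E]
  {F : Type v} [AddCommGroup F] [Module ℝ F] [TopologicalSpace F]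

/-- `w` is the directional derivative `df(x; v) = lim_{t → 0} t⁻¹ (f (x + t v) - f x)`. -/
def HasDirDeriv (f : E → F) (x v : E) (w : F) : Prop :=
  Tendsto (fun t : ℝ => t⁻¹ • (f (x + t • v) - f x)) (𝓝[≠] 0) (𝓝 w)

/-- The directional derivative `df(x; v)` (only meaningful where it exists). -/
def dirDeriv (f : E → F) (x v : E) : F :=
  limUnder (𝓝[≠] (0 : ℝ)) (fun t : ℝ => t⁻¹ • (f (x + t • v) - f x))

/-- The tangent map `Tf (x, v) = (f x, df(x; v))` of a map between open subsets of
locally convex spaces. -/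
def tangentFun (f : E → F) (z : E × E) : F × F :=
  (f z.1, dirDeriv f z.1 z.2)

end Calculus

/-- `f` is of class `C^n` in the sense of Bastiani on the (open) set `U`: it is continuous on `U`
and, for `n ≥ 1`, all directional derivatives `df(x; v)`, `x ∈ U`, exist and
`df : U × E → F` is of class `C^(n-1)`. -/
def BastianiCOn : ℕ → ∀ {E : Type u} [AddCommGroup E] [Module ℝ E] [TopologicalSpace E]
    {F : Type v} [AddCommGroup F] [Module ℝ F] [TopologicalSpace F],
    (E → F) → Set E → Prop
  | 0, _, _, _, _, _, _, _, _, f, U => ContinuousOn f U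
  | n + 1, _, _, _, _, _, _, _, _, f, U =>
      ContinuousOn f U ∧ (∀ x ∈ U, ∀ v, ∃ w, HasDirDeriv f x v w) ∧
        BastianiCOn n (fun z => dirDeriv f z.1 z.2) (U ×ˢ univ)

/-- Bastiani smoothness (`C^∞`) on an open set. -/
def BastianiSmoothOn {E : Type u} [AddCommGroup E] [Module ℝ E] [TopologicalSpace E]
    {F : Type v} [AddCommGroup F] [Module ℝ F] [TopologicalSpace F]
    (f : E → F) (U : Set E) : Prop :=
  ∀ n : ℕ, BastianiCOn n f U

/-- A locally convex Hausdorff space is a Fréchet space if it is metrizable (equivalently, first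
countable) and complete. -/
def IsFrechetSpace (E : Type u) [AddCommGroup E] [TopologicalSpace E]
    [IsTopologicalAddGroup E] : Prop :=
  FirstCountableTopology E ∧ @CompleteSpace E (IsTopologicalAddGroup.rightUniformSpace E)

/-! ### Manifolds modelled on a locally convex space, tangent vectors, vector fields -/

/-- A smooth manifold modelled on `E`: all changes of charts are Bastiani smooth. -/
class BastianiManifold (E : Type u) [AddCommGroup E] [Module ℝ E] [TopologicalSpace E]
    (M : Type w) [TopologicalSpace M] [ChartedSpace E M] : Prop where
  smooth_change : ∀ e ∈ atlas E M, ∀ e' ∈ atlas E M,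
    BastianiSmoothOn (fun y => e' (e.symm y)) (e.target ∩ e.symm ⁻¹' e'.source)

/-- The tangent space `T_p M`. As for tangent spaces in Mathlib, a tangent vector at `p` is
stored as its coordinate vector in the preferred chart `chartAt E p`. -/
abbrev TVec (E : Type u) {M : Type w} (_p : M) : Type u := E

section Manifold

variable {E : Type u} [AddCommGroup E] [Module ℝ E] [TopologicalSpace E]
  {M : Type w} [TopologicalSpace M] [ChartedSpace E M]

/-- The coordinates `T_p e (v)` of a tangent vector `v ∈ T_p M` in a chart `e` around `p`. -/
def tcoord (e : OpenPartialHomeomorph M E) (p : M) (v : TVec E p) : E :=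
  dirDeriv (fun y => e ((chartAt E p).symm y)) (chartAt E p p) v

/-- The tangent vector at `e⁻¹ y` whose coordinates in the chart `e` are `v`. -/
def tvec (e : OpenPartialHomeomorph M E) (y : E) (v : E) : TVec E (e.symm y) :=
  dirDeriv (fun z => chartAt E (e.symm y) (e.symm z)) y v

/-- The part of the image of the chart `e` that lies over `U`. -/
def chartImage (e : OpenPartialHomeomorph M E) (U : Opens M) : Set E :=
  e.target ∩ e.symm ⁻¹' (U : Set M)

/-- Smooth real functions on the open set `U` (values outside `U` are irrelevant). -/
def IsSmoothFun (U : Opens M) (f : M → ℝ) : Prop :=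
  ∀ e ∈ atlas E M, BastianiSmoothOn (fun y => f (e.symm y)) (chartImage e U)

/-- The local representative of a vector field in the chart `e`. -/
def localRep (e : OpenPartialHomeomorph M E) (X : ∀ p : M, TVec E p) (y : E) : E :=
  tcoord e (e.symm y) (X (e.symm y))

/-- Smooth vector fields on the open set `U` (values outside `U` are irrelevant). -/
def IsSmoothVF (U : Opens M) (X : ∀ p : M, TVec E p) : Prop :=
  ∀ e ∈ atlas E M, BastianiSmoothOn (localRep e X) (chartImage e U)

/-- Smooth families `(X_s)`, `s ∈ E`, of vector fields on the open set `U`: `(s, p) ↦ X_s p` is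
smooth on `E × U`. -/
def IsSmoothFamily (U : Opens M) (X : E → ∀ p : M, TVec E p) : Prop :=
  ∀ e ∈ atlas E M,
    BastianiSmoothOn (fun z : E × E => localRep e (X z.1) z.2) (univ ×ˢ chartImage e U)

/-- The derivative `(X.f)(p) = D_p f (X p)`. -/
def derivAlong (X : ∀ p : M, TVec E p) (f : M → ℝ) (p : M) : ℝ :=
  dirDeriv (fun y => f ((chartAt E p).symm y)) (chartAt E p p) (X p)

/-- The Lie bracket of vector fields, `[X, Y] = dY(·; X) - dX(·; Y)` in a chart. -/
def lieBracketVF (X Y : ∀ p : M, TVec E p) (p : M) : TVec E p :=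
  dirDeriv (localRep (chartAt E p) Y) (chartAt E p p) (X p) -
    dirDeriv (localRep (chartAt E p) X) (chartAt E p p) (Y p)

end Manifold

/-! ### Covariant derivatives -/

/-- A covariant derivative: an operator on the smooth vector fields over every open subset of the
manifold, compatible with restriction, function-linear in the first argument and a derivation
in the second. The axiom `restrict` also says that values outside `U` are irrelevant. -/
structure CovDeriv (E : Type u) [AddCommGroup E] [Module ℝ E] [TopologicalSpace E]
    (M : Type w) [TopologicalSpace M] [ChartedSpace E M] where
  nabla : Opens M → (∀ p : M, TVec E p) → (∀ p : M, TVec E p) → (∀ p : M, TVec E p)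
  smooth : ∀ U X Y, IsSmoothVF U X → IsSmoothVF U Y → IsSmoothVF U (nabla U X Y)
  restrict : ∀ U V : Opens M, V ≤ U → ∀ X Y X' Y',
    IsSmoothVF U X → IsSmoothVF U Y →
    (∀ p ∈ V, X' p = X p) → (∀ p ∈ V, Y' p = Y p) →
    ∀ p ∈ V, nabla V X' Y' p = nabla U X Y p
  add_left : ∀ U X X' Y, IsSmoothVF U X → IsSmoothVF U X' → IsSmoothVF U Y →
    ∀ p ∈ U, nabla U (fun q => X q + X' q) Y p = nabla U X Y p + nabla U X' Y p
  smul_left : ∀ U (f : M → ℝ) X Y, IsSmoothFun (E := E) U f → IsSmoothVF U X → IsSmoothVF U Y →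
    ∀ p ∈ U, nabla U (fun q => f q • X q) Y p = f p • nabla U X Y p
  add_right : ∀ U X Y Y', IsSmoothVF U X → IsSmoothVF U Y → IsSmoothVF U Y' →
    ∀ p ∈ U, nabla U X (fun q => Y q + Y' q) p = nabla U X Y p + nabla U X Y' p
  leibniz : ∀ U (f : M → ℝ) X Y, IsSmoothFun (E := E) U f → IsSmoothVF U X → IsSmoothVF U Y →
    ∀ p ∈ U, nabla U X (fun q => f q • Y q) p = derivAlong X f p • Y p + f p • nabla U X Y p

section Covariant

variable {E : Type u} [AddCommGroup E] [Module ℝ E] [TopologicalSpace E]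
  {M : Type w} [TopologicalSpace M] [ChartedSpace E M]

/-- Torsion-freeness: `∇_X Y - ∇_Y X = [X, Y]`. -/
def CovDeriv.IsTorsionFree (D : CovDeriv E M) : Prop :=
  ∀ U X Y, IsSmoothVF U X → IsSmoothVF U Y →
    ∀ p ∈ U, D.nabla U X Y p - D.nabla U Y X p = lieBracketVF X Y p

/-- The covariant derivative takes smooth families of vector fields to smooth families. -/
def CovDeriv.PreservesSmoothFamilies (D : CovDeriv E M) : Prop :=
  ∀ U (X Y : E → ∀ p : M, TVec E p), IsSmoothFamily U X → IsSmoothFamily U Y →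
    IsSmoothFamily U (fun s => D.nabla U (X s) (Y s))

end Covariant

/-! ### Weak Riemannian metrics -/

/-- A weak Riemannian metric: a smooth map `g : TM ⊕ TM → ℝ` that restricts to an inner product
on every tangent space. -/
structure WeakRiemannianMetric (E : Type u) [AddCommGroup E] [Module ℝ E] [TopologicalSpace E]
    (M : Type w) [TopologicalSpace M] [ChartedSpace E M] where
  val : ∀ p : M, TVec E p →ₗ[ℝ] TVec E p →ₗ[ℝ] ℝ
  symm : ∀ p v w, val p v w = val p w v
  nonneg : ∀ p v, 0 ≤ val p v v
  definite : ∀ p v, val p v v = 0 → v = 0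
  smooth : ∀ e ∈ atlas E M,
    BastianiSmoothOn
      (fun z : E × E × E => val (e.symm z.1) (tvec e z.1 z.2.1) (tvec e z.1 z.2.2))
      (e.target ×ˢ univ)

section Metric

variable {E : Type u} [AddCommGroup E] [Module ℝ E] [TopologicalSpace E]
  {M : Type w} [TopologicalSpace M] [ChartedSpace E M]

/-- The local representative `g_U(y, v, w)` of the metric in the chart `e`. -/
def WeakRiemannianMetric.localRep (g : WeakRiemannianMetric E M) (e : OpenPartialHomeomorph M E)
    (y v w : E) : ℝ :=
  g.val (e.symm y) (tvec e y v) (tvec e y w)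

/-- Compatibility with the metric: `X.g(Y, Z) = g(∇_X Y, Z) + g(Y, ∇_X Z)`. -/
def WeakRiemannianMetric.IsCompatible (g : WeakRiemannianMetric E M) (D : CovDeriv E M) : Prop :=
  ∀ U X Y Z, IsSmoothVF U X → IsSmoothVF U Y → IsSmoothVF U Z → ∀ p ∈ U,
    derivAlong X (fun q => g.val q (Y q) (Z q)) p =
      g.val p (D.nabla U X Y p) (Z p) + g.val p (Y p) (D.nabla U X Z p)

/-- The metric derivative (Levi-Civita covariant derivative) of `g` exists. If the model space
is not a Fréchet space, the covariant derivative is also required to preserve smooth families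
(for Fréchet spaces this is automatic). -/
def WeakRiemannianMetric.HasMetricDerivative [IsTopologicalAddGroup E]
    (g : WeakRiemannianMetric E M) : Prop :=
  ∃ D : CovDeriv E M, D.IsTorsionFree ∧ g.IsCompatible D ∧
    (IsFrechetSpace E ∨ D.PreservesSmoothFamilies)

/-! ### Hilbert completions of the tangent spaces -/

/-- The tangent space `T_p M`, with the inner product `g_p` and the norm induced by it. -/
def MetricFibre (_g : WeakRiemannianMetric E M) (p : M) : Type u := TVec E p

instance (g : WeakRiemannianMetric E M) (p : M) : AddCommGroup (MetricFibre g p) :=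
  inferInstanceAs (AddCommGroup E)

instance (g : WeakRiemannianMetric E M) (p : M) : Module ℝ (MetricFibre g p) :=
  inferInstanceAs (Module ℝ E)

/-- The inner product `g_p`. -/
@[reducible] def WeakRiemannianMetric.core (g : WeakRiemannianMetric E M) (p : M) :
    InnerProductSpace.Core ℝ (MetricFibre g p) where
  inner v w := g.val p v w
  conj_inner_symm v w := by simpa using g.symm p w v
  re_inner_nonneg v := by simpa using g.nonneg p v
  add_left v v' w := by
    exact LinearMap.congr_fun ((g.val p).map_add v v') w
  smul_left v w r := by
    exact LinearMap.congr_fun ((g.val p).map_smul r v) w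
  definite v h := g.definite p v h

instance (g : WeakRiemannianMetric E M) (p : M) : NormedAddCommGroup (MetricFibre g p) :=
  (g.core p).toNormedAddCommGroup

instance (g : WeakRiemannianMetric E M) (p : M) : InnerProductSpace ℝ (MetricFibre g p) :=
  InnerProductSpace.ofCore (g.core p).toCore

/-- The Hilbert space completion of `T_p M` with respect to `g_p`. -/
abbrev HilbertFibre (g : WeakRiemannianMetric E M) (p : M) : Type u :=
  UniformSpace.Completion (MetricFibre g p)

/-- The inclusion of `T_p M` in its Hilbert space completion. -/
def toHilbertFibre (g : WeakRiemannianMetric E M) (p : M) (v : TVec E p) : HilbertFibre g p :=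
  UniformSpace.Completion.coe' (show MetricFibre g p from v)

end Metric

/-- A smooth bundle trivialisation `TW ≅ W × E` of the tangent bundle over an open set `W`
(values outside `W` are irrelevant). -/
structure TangentTriv (E : Type u) [AddCommGroup E] [Module ℝ E] [TopologicalSpace E]
    (M : Type w) [TopologicalSpace M] [ChartedSpace E M] where
  W : Opens M
  triv : ∀ p : M, TVec E p ≃ₗ[ℝ] E
  smooth_triv : ∀ e ∈ atlas E M,
    BastianiSmoothOn (fun z : E × E => triv (e.symm z.1) (tvec e z.1 z.2))
      (chartImage e W ×ˢ univ)
  smooth_symm : ∀ e ∈ atlas E M,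
    BastianiSmoothOn (fun z : E × E => tcoord e (e.symm z.1) ((triv (e.symm z.1)).symm z.2))
      (chartImage e W ×ˢ univ)

/-- A local trivialisation of the union of the Hilbert completions of the tangent spaces, with
fibre a Hilbert space `H`, that extends a trivialisation `TW ≅ W × E` of the tangent bundle along
a continuous linear map `j : E → H` (values outside `W` are irrelevant). -/
structure CompletedTriv {E : Type u} [AddCommGroup E] [Module ℝ E] [TopologicalSpace E]
    {M : Type w} [TopologicalSpace M] [ChartedSpace E M] (g : WeakRiemannianMetric E M)
    extends TangentTriv E M where
  H : Type u
  [normed : NormedAddCommGroup H]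
  [inner : InnerProductSpace ℝ H]
  [complete : CompleteSpace H]
  j : E →L[ℝ] H
  ext : ∀ p : M, HilbertFibre g p →L[ℝ] H
  extSymm : ∀ p : M, H →L[ℝ] HilbertFibre g p
  left_inv : ∀ p ∈ W, ∀ x, extSymm p (ext p x) = x
  right_inv : ∀ p ∈ W, ∀ h, ext p (extSymm p h) = h
  ext_coe : ∀ p ∈ W, ∀ v : TVec E p, ext p (toHilbertFibre g p v) = j (triv p v)

attribute [instance] CompletedTriv.normed CompletedTriv.inner CompletedTriv.complete

/-! ### Sprays -/

/-- A spray: a smooth vector field `S` on `TM` with `Tπ ∘ S = id` and `S ∘ h_c = T h_c (c S)` for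
all real `c`, where `h_c` is multiplication by `c` in the fibres of `TM`.

As for `TVec`, the element `S p v` of the tangent space of `TM` at `(p, v)` is stored in the
coordinates of the chart of `TM` that belongs to the preferred chart of `M` at `p`; in these
coordinates `Tπ (a, b) = a` and `T h_c (a, b) = (a, c b)`. -/
structure Spray (E : Type u) [AddCommGroup E] [Module ℝ E] [TopologicalSpace E]
    (M : Type w) [TopologicalSpace M] [ChartedSpace E M] where
  toFun : ∀ p : M, TVec E p → E × E
  smooth : ∀ e ∈ atlas E M,
    BastianiSmoothOn
      (fun z : E × E =>
        dirDeriv (tangentFun fun y => e ((chartAt E (e.symm z.1)).symm y))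
          (chartAt E (e.symm z.1) (e.symm z.1), tvec e z.1 z.2)
          (toFun (e.symm z.1) (tvec e z.1 z.2)))
      (e.target ×ˢ univ)
  proj : ∀ p v, (toFun p v).1 = v
  homogeneous : ∀ (c : ℝ) p v,
    toFun p (c • v) = ((c • toFun p v).1, c • (c • toFun p v).2)

section Hesse

variable {E : Type u} [AddCommGroup E] [Module ℝ E] [TopologicalSpace E]
  {M : Type w} [TopologicalSpace M] [ChartedSpace E M]

/-- The principal part of the local representative of a spray in the chart `e`: the second tangent
map of the change of charts is applied to the value of `S` at the tangent vector with
base point coordinates `y` and coordinates `v`. The result is `(v, Γ_U(y, v))`. -/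
def Spray.localRep (S : Spray E M) (e : OpenPartialHomeomorph M E) (y v : E) : E × E :=
  dirDeriv (tangentFun fun z => e ((chartAt E (e.symm y)).symm z))
    (chartAt E (e.symm y) (e.symm y), tvec e y v) (S.toFun (e.symm y) (tvec e y v))

/-- The quadratic form `Γ_U(y, v)` of a spray in the chart `e`. -/
def Spray.quadForm (S : Spray E M) (e : OpenPartialHomeomorph M E) (y v : E) : E :=
  (S.localRep e y v).2

/-- `S` is a metric spray of `g`: in every chart,
`g_U(y, Γ_U(y, v), w) = 1/2 d₁g_U(y, v, v; w) - d₁g_U(y, v, w; v)`. -/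
def WeakRiemannianMetric.IsMetricSpray (g : WeakRiemannianMetric E M) (S : Spray E M) : Prop :=
  ∀ e ∈ atlas E M, ∀ y ∈ e.target, ∀ v w : E,
    g.localRep e y (S.quadForm e y v) w =
      (1 / 2 : ℝ) * dirDeriv (fun x => g.localRep e x v v) y w -
        dirDeriv (fun x => g.localRep e x v w) y v

/-- `(M, g)` is a Hesse manifold: it admits a metric spray. -/
def WeakRiemannianMetric.IsHesse (g : WeakRiemannianMetric E M) : Prop :=
  ∃ S : Spray E M, g.IsMetricSpray S

/-- The Hilbert completions of the tangent spaces form a smooth vector bundle over `M` whose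
trivialisations extend bundle trivialisations of `TM`: there are such trivialisations
around all points, and the changes of trivialisations `(x, h) ↦ ext' x (ext x)⁻¹ h` are smooth. -/
def WeakRiemannianMetric.CompletionsFormBundle (g : WeakRiemannianMetric E M) : Prop :=
  ∃ T : M → CompletedTriv g, (∀ p, p ∈ (T p).W) ∧
    ∀ p q, ∀ e ∈ atlas E M,
      BastianiSmoothOn
        (fun z : E × (T p).H => (T q).ext (e.symm z.1) ((T p).extSymm (e.symm z.1) z.2))
        (chartImage e ((T p).W ⊓ (T q).W) ×ˢ univ)

/-- `g` is a robust Riemannian metric. -/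
def WeakRiemannianMetric.IsRobust [IsTopologicalAddGroup E]
    (g : WeakRiemannianMetric E M) : Prop :=
  g.CompletionsFormBundle ∧ g.HasMetricDerivative

end Hesse

end

/-! The spray comes from the metric derivative `D`. In a chart, let C(y; v, w) be the local
representative of ∇_X Y for the fields X, Y with constant coordinates v, w (`CovDeriv.christoffel`).
Compatibility and vanishing torsion give the Koszul formula 2 g(C(v, w), z) = d₁g(w, z; v) + d₁g(v,
z; w) - d₁g(v, w; z). For v = w it says that Γ(y, v) = -C(y; v, v) solves the equation of a metric
spray. Since g is definite, the formula determines C, and symmetry and bilinearity of C are read off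
from its right-hand side. A weak metric need not represent every continuous functional, so the
existence of C has to come from `D`.

Two things remain. The first is joint smoothness of (y, v) ↦ C(y; v, v)
(`CovDeriv.smooth_christoffel_diag`); the definition of `D` only gives smoothness in y for fixed v,
w. If `D` preserves smooth families, it is applied to the family of constant fields. If E is a
Fréchet space, the Koszul formula shows that v ↦ C(y; v, w) has closed graph, hence is continuous,
and Banach–Steinhaus turns separate into joint smoothness (`bastianiSmoothOn_of_separately`).

The second is that the forms -C(y; v, v) of different charts define one vector field on TM
(`CovDeriv.sprayFun_localRep`). A field that is constant in one chart is differentiated in another;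
the second derivative of the change of charts that appears is the one in the transformation law of a
spray. -/

set_option linter.unusedSectionVars false

/-! ### Directional derivatives and the mean value theorem. -/

section BastianiCalculus

variable {E : Type*} [AddCommGroup E] [Module ℝ E] [TopologicalSpace E]
  {F : Type*} [AddCommGroup F] [Module ℝ F] [TopologicalSpace F]

theorem HasDirDeriv.dirDeriv_eq [T2Space F] {f : E → F} {x v : E} {w : F}
    (h : HasDirDeriv f x v w) : dirDeriv f x v = w :=
  Tendsto.limUnder_eq h

theorem hasDirDeriv_zero (f : E → F) (x : E) : HasDirDeriv f x 0 0 := by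
  simpa [HasDirDeriv] using tendsto_const_nhds

theorem tendsto_mul_left_punctured {r : ℝ} (hr : r ≠ 0) :
    Tendsto (fun t : ℝ => t * r) (𝓝[≠] 0) (𝓝[≠] 0) := by
  refine tendsto_nhdsWithin_iff.2 ⟨?_, ?_⟩
  · exact tendsto_nhdsWithin_of_tendsto_nhds (by
      simpa using (continuous_mul_const r).tendsto (0 : ℝ))
  · filter_upwards [self_mem_nhdsWithin] with t ht
    exact mul_ne_zero ht hr

theorem HasDirDeriv.smul [ContinuousConstSMul ℝ F] {f : E → F} {x v : E} {w : F}
    (h : HasDirDeriv f x v w) (r : ℝ) : HasDirDeriv f x (r • v) (r • w) := by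
  rcases eq_or_ne r 0 with rfl | hr
  · simpa using hasDirDeriv_zero f x
  · have := (h.comp (tendsto_mul_left_punctured hr)).const_smul r
    refine this.congr fun t => ?_
    simp only [Function.comp, smul_smul, mul_inv]
    congr 1
    field_simp

theorem HasDirDeriv.congr {f g : E → F} {x v : E} {w : F}
    [ContinuousAdd E] [ContinuousSMul ℝ E]
    (h : HasDirDeriv f x v w) (hfg : f =ᶠ[𝓝 x] g) : HasDirDeriv g x v w := by
  have h1 : Tendsto (fun t : ℝ => x + t • v) (𝓝[≠] 0) (𝓝 x) := by
    refine tendsto_nhdsWithin_of_tendsto_nhds ?_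
    have : Continuous fun t : ℝ => x + t • v := by fun_prop
    simpa using this.tendsto 0
  refine Tendsto.congr' ?_ h
  filter_upwards [h1.eventually hfg] with t ht
  rw [ht, hfg.eq_of_nhds]

theorem dirDeriv_congr {f g : E → F} {x : E} [ContinuousAdd E] [ContinuousSMul ℝ E]
    (hfg : f =ᶠ[𝓝 x] g) (v : E) : dirDeriv f x v = dirDeriv g x v := by
  have h1 : Tendsto (fun t : ℝ => x + t • v) (𝓝[≠] 0) (𝓝 x) := by
    refine tendsto_nhdsWithin_of_tendsto_nhds ?_
    have : Continuous fun t : ℝ => x + t • v := by fun_prop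
    simpa using this.tendsto 0
  have : (fun t : ℝ => t⁻¹ • (f (x + t • v) - f x)) =ᶠ[𝓝[≠] 0]
      fun t : ℝ => t⁻¹ • (g (x + t • v) - g x) := by
    filter_upwards [h1.eventually hfg] with t ht
    rw [ht, hfg.eq_of_nhds]
  rw [dirDeriv, dirDeriv, limUnder, limUnder, Filter.map_congr this]

theorem ContinuousLinearMap.hasDirDeriv (L : E →L[ℝ] F) (x v : E) :
    HasDirDeriv L x v (L v) := by
  refine tendsto_const_nhds.congr' ?_
  filter_upwards [self_mem_nhdsWithin] with t ht
  rw [map_add, map_smul, add_sub_cancel_left, inv_smul_smul₀ ht]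

theorem HasDirDeriv.clm_comp {G : Type*} [AddCommGroup G] [Module ℝ G] [TopologicalSpace G]
    {f : E → F} {x v : E} {w : F} (h : HasDirDeriv f x v w) (L : F →L[ℝ] G) :
    HasDirDeriv (fun y => L (f y)) x v (L w) := by
  refine ((L.continuous.tendsto w).comp h).congr fun t => ?_
  simp

theorem HasDirDeriv.prodMk {G : Type*} [AddCommGroup G] [Module ℝ G] [TopologicalSpace G]
    {f : E → F} {g : E → G} {x v : E} {a : F} {b : G}
    (hf : HasDirDeriv f x v a) (hg : HasDirDeriv g x v b) :
    HasDirDeriv (fun y => (f y, g y)) x v (a, b) :=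
  Tendsto.prodMk_nhds hf hg

/-- Mean value theorem: the increment of a curve lies in every closed convex set that contains its
velocities. -/
theorem sub_mem_of_hasDirDeriv [IsTopologicalAddGroup F] [ContinuousSMul ℝ F]
    [LocallyConvexSpace ℝ F] {c c' : ℝ → F} {C : Set F} (hC : Convex ℝ C) (hcl : IsClosed C)
    (h : ∀ s ∈ Icc (0 : ℝ) 1, HasDirDeriv c s 1 (c' s)) (hc' : ∀ s ∈ Icc (0 : ℝ) 1, c' s ∈ C) :
    c 1 - c 0 ∈ C := by
  by_contra hn
  -- A functional separating the increment from `C` reduces the claim to the scalar mean value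
  -- theorem for `l ∘ c`.
  obtain ⟨l, r, hl, hr⟩ := geometric_hahn_banach_closed_point hC hcl hn
  have hd : ∀ s ∈ Icc (0 : ℝ) 1, HasDerivAt (fun s => l (c s)) (l (c' s)) s := fun s hs => by
    rw [hasDerivAt_iff_tendsto_slope_zero]
    simpa [HasDirDeriv] using (h s hs).clm_comp l
  obtain ⟨s, hs, he⟩ := exists_hasDerivAt_eq_slope (fun s => l (c s)) (fun s => l (c' s))
    zero_lt_one (fun s hs => (hd s hs).continuousAt.continuousWithinAt)
    (fun s hs => hd s (Ioo_subset_Icc_self hs))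
  have h1 := hl _ (hc' s (Ioo_subset_Icc_self hs))
  simp only [map_sub] at hr
  norm_num at he
  linarith

/-- Closed convex neighbourhoods are the sets to which `sub_mem_of_hasDirDeriv` applies, so limits
are tested on them. -/
theorem exists_closed_convex_mem_nhds [IsTopologicalAddGroup F] [ContinuousSMul ℝ F]
    [LocallyConvexSpace ℝ F] {a : F} {N : Set F} (hN : N ∈ 𝓝 a) :
    ∃ C ∈ 𝓝 a, Convex ℝ C ∧ IsClosed C ∧ C ⊆ N := by
  obtain ⟨K, ⟨hK, hKc⟩, hKN⟩ := (closed_nhds_basis a).mem_iff.1 hN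
  obtain ⟨C, ⟨hC, hCc⟩, hCK⟩ := (LocallyConvexSpace.convex_basis (𝕜 := ℝ) a).mem_iff.1 hK
  exact ⟨closure C, mem_of_superset hC subset_closure, hCc.closure, isClosed_closure,
    (closure_minimal hCK hKc).trans hKN⟩

/-- Restriction of a function to a line. -/
theorem HasDirDeriv.comp_line {f : E → F} {x v : E} {s : ℝ} {w : F}
    (h : HasDirDeriv f (x + s • v) v w) : HasDirDeriv (fun s : ℝ => f (x + s • v)) s 1 w := by
  refine Tendsto.congr (fun t => ?_) h
  simp [add_smul, add_assoc]

theorem HasDirDeriv.const_smul [ContinuousConstSMul ℝ F] {f : E → F} {x v : E} {w : F}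
    (h : HasDirDeriv f x v w) (r : ℝ) : HasDirDeriv (fun y => r • f y) x v (r • w) := by
  refine (Tendsto.const_smul h r).congr fun t => ?_
  rw [← smul_sub, smul_comm]

theorem HasDirDeriv.sub [IsTopologicalAddGroup F] {f g : E → F} {x v : E} {a b : F}
    (hf : HasDirDeriv f x v a) (hg : HasDirDeriv g x v b) :
    HasDirDeriv (fun y => f y - g y) x v (a - b) := by
  refine (Tendsto.sub hf hg).congr fun t => ?_
  rw [← smul_sub]; beta_reduce; congr 1; abel

theorem HasDirDeriv.add [IsTopologicalAddGroup F] {f g : E → F} {x v : E} {a b : F}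
    (hf : HasDirDeriv f x v a) (hg : HasDirDeriv g x v b) :
    HasDirDeriv (fun y => f y + g y) x v (a + b) := by
  refine (Tendsto.add hf hg).congr fun t => ?_
  rw [← smul_add]; beta_reduce; congr 1; abel

end BastianiCalculus

/-! ### Chain rule and linearity of the derivative for C^1 maps. -/

section BastianiChain

variable {E : Type u} [AddCommGroup E] [Module ℝ E] [TopologicalSpace E]
  [IsTopologicalAddGroup E] [ContinuousSMul ℝ E] [LocallyConvexSpace ℝ E]
  {F : Type v} [AddCommGroup F] [Module ℝ F] [TopologicalSpace F]
  [IsTopologicalAddGroup F] [ContinuousSMul ℝ F] [LocallyConvexSpace ℝ F] [T2Space F]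
  {G : Type w} [AddCommGroup G] [Module ℝ G] [TopologicalSpace G]
  [IsTopologicalAddGroup G] [ContinuousSMul ℝ G] [LocallyConvexSpace ℝ G] [T2Space G]

theorem BastianiCOn.continuousOn {n : ℕ} {f : E → F} {U : Set E} (h : BastianiCOn n f U) :
    ContinuousOn f U := by
  cases n with
  | zero => exact h
  | succ n => exact h.1

theorem BastianiCOn.hasDirDeriv {n : ℕ} {f : E → F} {U : Set E} (h : BastianiCOn (n + 1) f U)
    {x : E} (hx : x ∈ U) (v : E) : HasDirDeriv f x v (dirDeriv f x v) := by
  obtain ⟨w, hw⟩ := h.2.1 x hx v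
  rwa [hw.dirDeriv_eq]

/-- For a `C^1` map, the difference quotients converge also along moving base points and moving
directions. -/
theorem BastianiCOn.tendsto_slope {f : E → F} {U : Set E} (hU : IsOpen U)
    (h : BastianiCOn 1 f U) {x v : E} (hx : x ∈ U) {ι : Type*} {l : Filter ι} {t : ι → ℝ}
    {y w : ι → E} (ht0 : ∀ᶠ i in l, t i ≠ 0) (ht : Tendsto t l (𝓝 0)) (hy : Tendsto y l (𝓝 x))
    (hw : Tendsto w l (𝓝 v)) :
    Tendsto (fun i => (t i)⁻¹ • (f (y i + t i • w i) - f (y i))) l (𝓝 (dirDeriv f x v)) := by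
  intro N hN
  obtain ⟨C, hC, hCc, hCcl, hCN⟩ := exists_closed_convex_mem_nhds hN
  have hopen : IsOpen (U ×ˢ (univ : Set E)) := hU.prod isOpen_univ
  have hcont : ContinuousAt (fun z : E × E => dirDeriv f z.1 z.2) (x, v) :=
    h.2.2.continuousOn.continuousAt (hopen.mem_nhds ⟨hx, trivial⟩)
  have hpre : (fun z : E × E => dirDeriv f z.1 z.2) ⁻¹' C ∩ U ×ˢ univ ∈ 𝓝 (x, v) :=
    inter_mem (hcont hC) (hopen.mem_nhds ⟨hx, trivial⟩)
  obtain ⟨A, hA, B, hB, hAB⟩ := mem_nhds_prod_iff.1 hpre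
  obtain ⟨A', ⟨hA', hA'c⟩, hA'A⟩ := (LocallyConvexSpace.convex_basis (𝕜 := ℝ) x).mem_iff.1 hA
  have hyw : Tendsto (fun i => y i + t i • w i) l (𝓝 x) := by
    simpa using hy.add (ht.smul hw)
  refine mem_map.2 ?_
  filter_upwards [ht0, hy.eventually hA', hyw.eventually hA', hw.eventually hB] with i hi hyi hywi hwi
  apply hCN
  have key : ∀ s ∈ Icc (0 : ℝ) 1, (y i + s • (t i • w i), w i) ∈ A' ×ˢ B := fun s hs =>
    ⟨hA'c.add_smul_mem hyi hywi hs, hwi⟩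
  -- The difference quotient is the increment over [0, 1] of this rescaled curve; its velocities are
  -- values of df near (x, v), hence lie in `C`.
  have := sub_mem_of_hasDirDeriv (c := fun s => (t i)⁻¹ • f (y i + s • (t i • w i)))
    (c' := fun s => (t i)⁻¹ • t i • dirDeriv f (y i + s • (t i • w i)) (w i)) hCc hCcl
    (fun s hs => ?_) (fun s hs => ?_)
  · simpa [smul_sub] using this
  · have hm := hAB (prod_mono_left hA'A (key s hs))
    exact (((h.hasDirDeriv hm.2.1 (w i)).smul (t i)).comp_line).const_smul _
  · have hm := hAB (prod_mono_left hA'A (key s hs))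
    rw [inv_smul_smul₀ hi]
    exact hm.1

/-- With w(t) the difference quotient of f, f(x + tv) = f(x) + t w(t) and w(t) → a. This is a slope
of g along a moving direction, so f needs only this one directional derivative. -/
theorem BastianiCOn.hasDirDeriv_comp {g : F → G} {V : Set F} (hV : IsOpen V)
    (hg : BastianiCOn 1 g V) {f : E → F} {x v : E} {a : F} (hx : f x ∈ V)
    (hf : HasDirDeriv f x v a) :
    HasDirDeriv (fun y => g (f y)) x v (dirDeriv g (f x) a) := by
  have := hg.tendsto_slope hV hx (l := 𝓝[≠] (0 : ℝ)) (t := id) (y := fun _ => f x)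
    self_mem_nhdsWithin (tendsto_id.mono_left nhdsWithin_le_nhds) tendsto_const_nhds hf
  refine this.congr' ?_
  filter_upwards [self_mem_nhdsWithin] with t ht
  simp [smul_inv_smul₀ (show t ≠ 0 from ht)]

theorem tendsto_add_smul_punctured (x v : E) :
    Tendsto (fun t : ℝ => x + t • v) (𝓝[≠] 0) (𝓝 x) := by
  refine tendsto_nhdsWithin_of_tendsto_nhds ?_
  have : Continuous fun t : ℝ => x + t • v := by fun_prop
  simpa using this.tendsto 0

/-- The increment along t(v + w) is split at x + tv; its second half is a slope with moving base
point. -/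
theorem BastianiCOn.dirDeriv_add {f : E → F} {U : Set E} (hU : IsOpen U)
    (h : BastianiCOn 1 f U) {x : E} (hx : x ∈ U) (v w : E) :
    dirDeriv f x (v + w) = dirDeriv f x v + dirDeriv f x w := by
  refine HasDirDeriv.dirDeriv_eq ?_
  have h1 := h.tendsto_slope hU hx (v := w) (l := 𝓝[≠] (0 : ℝ)) (t := id)
    (y := fun t => x + t • v) (w := fun _ => w)
    self_mem_nhdsWithin (tendsto_id.mono_left nhdsWithin_le_nhds) (tendsto_add_smul_punctured x v)
    tendsto_const_nhds
  refine (Tendsto.add (h.hasDirDeriv hx v) h1).congr fun t => ?_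
  rw [id, ← smul_add, smul_add t v w, ← add_assoc]
  congr 1; abel

theorem BastianiCOn.dirDeriv_smul {f : E → F} {U : Set E} (h : BastianiCOn 1 f U) {x : E}
    (hx : x ∈ U) (r : ℝ) (v : E) : dirDeriv f x (r • v) = r • dirDeriv f x v :=
  ((h.hasDirDeriv hx v).smul r).dirDeriv_eq

end BastianiChain

/-! ### Stability of the classes C^n under composition, and symmetry of second derivatives. -/

section BastianiStability

variable {E : Type u} [AddCommGroup E] [Module ℝ E] [TopologicalSpace E]
  [IsTopologicalAddGroup E] [ContinuousSMul ℝ E] [LocallyConvexSpace ℝ E] [T2Space E]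
  {F : Type v} [AddCommGroup F] [Module ℝ F] [TopologicalSpace F]
  [IsTopologicalAddGroup F] [ContinuousSMul ℝ F] [LocallyConvexSpace ℝ F] [T2Space F]
  {G : Type w} [AddCommGroup G] [Module ℝ G] [TopologicalSpace G]
  [IsTopologicalAddGroup G] [ContinuousSMul ℝ G] [LocallyConvexSpace ℝ G] [T2Space G]

theorem BastianiCOn.of_succ {n : ℕ} {f : E → F} {U : Set E} (h : BastianiCOn (n + 1) f U) :
    BastianiCOn n f U := by
  induction n generalizing E F with
  | zero => exact h.1
  | succ n ih => exact ⟨h.1, h.2.1, ih h.2.2⟩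

theorem BastianiCOn.one {n : ℕ} {f : E → F} {U : Set E} (h : BastianiCOn (n + 1) f U) :
    BastianiCOn 1 f U :=
  ⟨h.1, h.2.1, h.2.2.continuousOn⟩

theorem BastianiCOn.mono {n : ℕ} {f : E → F} {U V : Set E} (h : BastianiCOn n f U)
    (hVU : V ⊆ U) : BastianiCOn n f V := by
  induction n generalizing E F with
  | zero => exact ContinuousOn.mono h hVU
  | succ n ih =>
    exact ⟨h.1.mono hVU, fun x hx => h.2.1 x (hVU hx), ih h.2.2 (prod_mono_left hVU)⟩

theorem BastianiCOn.congr {n : ℕ} {f g : E → F} {U : Set E} (hU : IsOpen U)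
    (h : BastianiCOn n f U) (hfg : EqOn f g U) : BastianiCOn n g U := by
  induction n generalizing E F with
  | zero => exact ContinuousOn.congr h hfg.symm
  | succ n ih =>
    have hev : ∀ x ∈ U, f =ᶠ[𝓝 x] g := fun x hx => mem_of_superset (hU.mem_nhds hx) hfg
    refine ⟨h.1.congr hfg.symm, fun x hx v => ?_, ih (hU.prod isOpen_univ) h.2.2 ?_⟩
    · obtain ⟨w, hw⟩ := h.2.1 x hx v
      exact ⟨w, hw.congr (hev x hx)⟩
    · rintro ⟨x, v⟩ ⟨hx, -⟩
      exact dirDeriv_congr (hev x hx) v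

theorem ContinuousLinearMap.bastianiCOn (L : E →L[ℝ] F) (n : ℕ) (U : Set E) :
    BastianiCOn n L U := by
  refine BastianiCOn.mono ?_ (subset_univ U)
  induction n generalizing E F with
  | zero => exact L.continuous.continuousOn
  | succ n ih =>
    refine ⟨L.continuous.continuousOn, fun x _ v => ⟨_, L.hasDirDeriv x v⟩, ?_⟩
    rw [univ_prod_univ]
    refine (ih (L.comp (ContinuousLinearMap.snd ℝ E E)) univ).congr isOpen_univ ?_
    rintro ⟨x, v⟩ -
    exact (L.hasDirDeriv x v).dirDeriv_eq.symm

theorem bastianiCOn_const (n : ℕ) (c : F) (U : Set E) :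
    BastianiCOn n (fun _ : E => c) U := by
  have hd : ∀ (x v : E), HasDirDeriv (fun _ : E => c) x v 0 := fun x v => by
    simp [HasDirDeriv]
  cases n with
  | zero => exact continuousOn_const
  | succ n =>
    refine ⟨continuousOn_const, fun x _ v => ⟨_, hd x v⟩, ?_⟩
    refine (((0 : (E × E) →L[ℝ] F).bastianiCOn n univ).congr isOpen_univ ?_).mono (subset_univ _)
    rintro ⟨x, v⟩ -
    exact (hd x v).dirDeriv_eq.symm

theorem BastianiCOn.prodMk {n : ℕ} {f : E → F} {g : E → G} {U : Set E} (hU : IsOpen U)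
    (hf : BastianiCOn n f U) (hg : BastianiCOn n g U) :
    BastianiCOn n (fun x => (f x, g x)) U := by
  induction n generalizing E F G with
  | zero => exact ContinuousOn.prodMk hf hg
  | succ n ih =>
    refine ⟨hf.1.prodMk hg.1, fun x hx v =>
      ⟨_, (hf.hasDirDeriv hx v).prodMk (hg.hasDirDeriv hx v)⟩, ?_⟩
    refine (ih (hU.prod isOpen_univ) hf.2.2 hg.2.2).congr (hU.prod isOpen_univ) ?_
    rintro ⟨x, v⟩ ⟨hx, -⟩
    exact ((hf.hasDirDeriv hx v).prodMk (hg.hasDirDeriv hx v)).dirDeriv_eq.symm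

theorem HasDirDeriv.comp_clm {f : F → G} {x v : E} {w : G} (L : E →L[ℝ] F)
    (h : HasDirDeriv f (L x) (L v) w) : HasDirDeriv (fun y => f (L y)) x v w := by
  refine Tendsto.congr (fun t => ?_) h
  simp

/-- This precedes the general composition theorem because the induction there needs (x, v) ↦ f x to
be of class C^n. -/
theorem BastianiCOn.comp_clm {n : ℕ} {f : F → G} {V : Set F} {U : Set E}
    (hf : BastianiCOn n f V) (L : E →L[ℝ] F) (hU : IsOpen U) (hL : MapsTo L U V) :
    BastianiCOn n (fun x => f (L x)) U := by
  induction n generalizing E F with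
  | zero => exact ContinuousOn.comp hf L.continuous.continuousOn hL
  | succ n ih =>
    have hd : ∀ x ∈ U, ∀ v, HasDirDeriv (fun x => f (L x)) x v (dirDeriv f (L x) (L v)) :=
      fun x hx v => (hf.hasDirDeriv (hL hx) (L v)).comp_clm L
    refine ⟨hf.1.comp L.continuous.continuousOn hL, fun x hx v => ⟨_, hd x hx v⟩, ?_⟩
    refine (ih hf.2.2 (L.prodMap L) (hU.prod isOpen_univ)
      (fun z hz => ⟨hL hz.1, trivial⟩)).congr (hU.prod isOpen_univ) ?_
    rintro ⟨x, v⟩ ⟨hx, -⟩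
    exact (hd x hx v).dirDeriv_eq.symm

theorem BastianiCOn.comp {n : ℕ} {g : F → G} {V : Set F} {f : E → F} {U : Set E}
    (hg : BastianiCOn n g V) (hf : BastianiCOn n f U) (hV : IsOpen V) (hU : IsOpen U)
    (hfU : MapsTo f U V) : BastianiCOn n (fun x => g (f x)) U := by
  induction n generalizing E F G with
  | zero => exact ContinuousOn.comp hg hf hfU
  | succ n ih =>
    have hd : ∀ x ∈ U, ∀ v, HasDirDeriv (fun x => g (f x)) x v
        (dirDeriv g (f x) (dirDeriv f x v)) := fun x hx v =>
      hg.one.hasDirDeriv_comp hV (hfU hx) (hf.hasDirDeriv hx v)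
    refine ⟨hg.1.comp hf.1 hfU, fun x hx v => ⟨_, hd x hx v⟩, ?_⟩
    have hO := hU.prod (isOpen_univ (X := E))
    have h1 : BastianiCOn n (fun z : E × E => f z.1) (U ×ˢ univ) :=
      hf.of_succ.comp_clm (ContinuousLinearMap.fst ℝ E E) hO (fun z hz => hz.1)
    refine (ih hg.2.2 (h1.prodMk hO hf.2.2) (hV.prod isOpen_univ) hO
      (fun z hz => ⟨hfU hz.1, trivial⟩)).congr hO ?_
    rintro ⟨x, v⟩ ⟨hx, -⟩
    exact (hd x hx v).dirDeriv_eq.symm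

theorem BastianiSmoothOn.congr {f g : E → F} {U : Set E} (h : BastianiSmoothOn f U)
    (hU : IsOpen U) (hfg : EqOn f g U) : BastianiSmoothOn g U :=
  fun n => (h n).congr hU hfg

theorem ContinuousLinearMap.bastianiSmoothOn (L : E →L[ℝ] F) (U : Set E) :
    BastianiSmoothOn L U :=
  fun n => L.bastianiCOn n U

theorem bastianiSmoothOn_const (c : F) (U : Set E) : BastianiSmoothOn (fun _ : E => c) U :=
  fun n => bastianiCOn_const n c U

theorem BastianiSmoothOn.prodMk {f : E → F} {g : E → G} {U : Set E}
    (hf : BastianiSmoothOn f U) (hg : BastianiSmoothOn g U) (hU : IsOpen U) :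
    BastianiSmoothOn (fun x => (f x, g x)) U :=
  fun n => (hf n).prodMk hU (hg n)

theorem BastianiSmoothOn.comp {g : F → G} {V : Set F} {f : E → F} {U : Set E}
    (hg : BastianiSmoothOn g V) (hf : BastianiSmoothOn f U) (hV : IsOpen V) (hU : IsOpen U)
    (hfU : MapsTo f U V) : BastianiSmoothOn (fun x => g (f x)) U :=
  fun n => (hg n).comp (hf n) hV hU hfU

theorem BastianiSmoothOn.clm_comp {f : E → F} {U : Set E} (hf : BastianiSmoothOn f U)
    (L : F →L[ℝ] G) (hU : IsOpen U) : BastianiSmoothOn (fun x => L (f x)) U :=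
  (L.bastianiSmoothOn univ).comp hf isOpen_univ hU (mapsTo_univ _ _)

theorem BastianiSmoothOn.comp_clm {g : F → G} {V : Set F} {U : Set E}
    (hg : BastianiSmoothOn g V) (L : E →L[ℝ] F) (hU : IsOpen U)
    (hL : MapsTo L U V) : BastianiSmoothOn (fun x => g (L x)) U :=
  fun n => (hg n).comp_clm L hU hL

theorem BastianiSmoothOn.dirDeriv {f : E → F} {U : Set E} (hf : BastianiSmoothOn f U) :
    BastianiSmoothOn (fun z : E × E => dirDeriv f z.1 z.2) (U ×ˢ univ) :=
  fun n => (hf (n + 1)).2.2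

theorem BastianiSmoothOn.hasDirDeriv {f : E → F} {U : Set E} (hf : BastianiSmoothOn f U)
    {x : E} (hx : x ∈ U) (v : E) : HasDirDeriv f x v (_root_.dirDeriv f x v) :=
  (hf 1).hasDirDeriv hx v

theorem BastianiSmoothOn.hasDirDeriv_comp {g : F → G} {V : Set F} (hg : BastianiSmoothOn g V)
    (hV : IsOpen V) {f : E → F} {x v : E} {a : F} (hx : f x ∈ V) (hf : HasDirDeriv f x v a) :
    HasDirDeriv (fun y => g (f y)) x v (_root_.dirDeriv g (f x) a) :=
  (hg 1).hasDirDeriv_comp hV hx hf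

theorem BastianiSmoothOn.dirDeriv_comp {g : F → G} {V : Set F} (hg : BastianiSmoothOn g V)
    (hV : IsOpen V) {f : E → F} {x v : E} {a : F} (hx : f x ∈ V) (hf : HasDirDeriv f x v a) :
    _root_.dirDeriv (fun y => g (f y)) x v = _root_.dirDeriv g (f x) a :=
  (hg.hasDirDeriv_comp hV hx hf).dirDeriv_eq

theorem BastianiSmoothOn.dirDeriv_add {f : E → F} {U : Set E} (hf : BastianiSmoothOn f U)
    (hU : IsOpen U) {x : E} (hx : x ∈ U) (v w : E) :
    _root_.dirDeriv f x (v + w) = _root_.dirDeriv f x v + _root_.dirDeriv f x w :=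
  (hf 1).dirDeriv_add hU hx v w

theorem BastianiSmoothOn.dirDeriv_smul {f : E → F} {U : Set E} (hf : BastianiSmoothOn f U)
    {x : E} (hx : x ∈ U) (r : ℝ) (v : E) :
    _root_.dirDeriv f x (r • v) = r • _root_.dirDeriv f x v :=
  (hf 1).dirDeriv_smul hx r v

theorem hasDirDeriv_id (x v : E) : HasDirDeriv (fun y : E => y) x v v :=
  (ContinuousLinearMap.id ℝ E).hasDirDeriv x v

theorem hasDirDeriv_const (c : F) (x v : E) : HasDirDeriv (fun _ : E => c) x v 0 := by
  simp [HasDirDeriv]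

/-- The derivative of `df(·; a(·))`, where `a` is a curve of directions. -/
theorem BastianiSmoothOn.dirDeriv_fst_snd {f : E → F} {U : Set E} (hf : BastianiSmoothOn f U)
    (hU : IsOpen U) {x : E} (hx : x ∈ U) (v h k : E) :
    _root_.dirDeriv (fun z : E × E => _root_.dirDeriv f z.1 z.2) (x, v) (h, k) =
      _root_.dirDeriv (fun y => _root_.dirDeriv f y v) x h + _root_.dirDeriv f x k := by
  have hO := hU.prod (isOpen_univ (X := E))
  have e : ((h, k) : E × E) = (h, 0) + (0, k) := by simp
  rw [e, hf.dirDeriv.dirDeriv_add hO ⟨hx, trivial⟩]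
  congr 1
  · exact (hf.dirDeriv.dirDeriv_comp hO (f := fun y => (y, v)) (x := x) (v := h)
      ⟨hx, trivial⟩ ((hasDirDeriv_id x h).prodMk (hasDirDeriv_const v x h))).symm
  -- By linearity of df(x; ·) the difference quotient in the second variable is constant for t ≠ 0.
  · refine HasDirDeriv.dirDeriv_eq (tendsto_const_nhds.congr' ?_)
    filter_upwards [self_mem_nhdsWithin] with t ht
    simp [hf.dirDeriv_add hU hx, hf.dirDeriv_smul hx, inv_smul_smul₀ (show t ≠ 0 from ht)]

/-- Symmetry of second derivatives. -/
theorem BastianiSmoothOn.dirDeriv_comm {f : E → F} {U : Set E} (hf : BastianiSmoothOn f U)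
    (hU : IsOpen U) {x : E} (hx : x ∈ U) (v w : E) :
    _root_.dirDeriv (fun y => _root_.dirDeriv f y v) x w =
      _root_.dirDeriv (fun y => _root_.dirDeriv f y w) x v := by
  -- The second difference quotient is symmetric in v and w, so it is enough that it converges to
  -- one of the iterated derivatives.
  suffices H : ∀ v w : E, Tendsto (fun t : ℝ => (t⁻¹ * t⁻¹) •
      ((f (x + t • v + t • w) - f (x + t • v)) - (f (x + t • w) - f x))) (𝓝[≠] 0)
      (𝓝 (_root_.dirDeriv (fun y => _root_.dirDeriv f y v) x w)) by
    refine tendsto_nhds_unique (H v w) ((H w v).congr fun t => ?_)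
    congr 1
    rw [add_right_comm]
    abel
  clear v w
  intro v w N hN
  obtain ⟨C, hC, hCc, hCcl, hCN⟩ := exists_closed_convex_mem_nhds hN
  have hsm : BastianiSmoothOn (fun y => _root_.dirDeriv f y v) U :=
    hf.dirDeriv.comp (f := fun y => (y, v)) (((ContinuousLinearMap.id ℝ E).bastianiSmoothOn U).prodMk
      (bastianiSmoothOn_const v U) hU) (hU.prod isOpen_univ) hU (fun y hy => ⟨hy, trivial⟩)
  have hcont : ContinuousAt (fun y => _root_.dirDeriv (fun y => _root_.dirDeriv f y v) y w) x := by
    have : ContinuousOn (fun y => _root_.dirDeriv (fun y => _root_.dirDeriv f y v) y w) U :=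
      (hsm.dirDeriv 0).continuousOn.comp (f := fun y => (y, w))
        (continuousOn_id.prodMk continuousOn_const) (fun y hy => ⟨hy, trivial⟩)
    exact this.continuousAt (hU.mem_nhds hx)
  obtain ⟨A, ⟨hA, hAc⟩, hAU⟩ := (LocallyConvexSpace.convex_basis (𝕜 := ℝ) x).mem_iff.1
    (inter_mem (hcont hC) (hU.mem_nhds hx))
  have hAx : x ∈ A := mem_of_mem_nhds hA
  have tvw : Tendsto (fun t : ℝ => x + t • v + t • w) (𝓝[≠] 0) (𝓝 x) := by
    simpa [add_assoc] using tendsto_add_smul_punctured x (v + w)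
  refine mem_map.2 ?_
  filter_upwards [(tendsto_add_smul_punctured x v).eventually hA,
    (tendsto_add_smul_punctured x w).eventually hA, tvw.eventually hA, self_mem_nhdsWithin]
    with t hv hw hvw ht
  have hin1 : ∀ s ∈ Icc (0 : ℝ) 1, x + s • (t • v) ∈ A := fun s hs =>
    hAc.add_smul_mem hAx hv hs
  have hin2 : ∀ s ∈ Icc (0 : ℝ) 1, x + t • w + s • (t • v) ∈ A := fun s hs =>
    hAc.add_smul_mem hw (by rwa [add_right_comm]) hs
  apply hCN
  -- The mean value theorem is used twice: along tv for the difference of f at points that differ by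
  -- tw, then along tw for df(·; v).
  have key := sub_mem_of_hasDirDeriv
    (c := fun s => (t⁻¹ * t⁻¹) • (f (x + t • w + s • (t • v)) - f (x + s • (t • v))))
    (c' := fun s => (t⁻¹ * t⁻¹) • (t • _root_.dirDeriv f (x + t • w + s • (t • v)) v -
      t • _root_.dirDeriv f (x + s • (t • v)) v)) hCc hCcl
    (fun s hs => ((((hf.hasDirDeriv (hAU (hin2 s hs)).2 v).smul t).comp_line).sub
      (((hf.hasDirDeriv (hAU (hin1 s hs)).2 v).smul t).comp_line)).const_smul _)
    (fun s hs => ?_)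
  · convert key using 1
    simp only [one_smul, zero_smul, add_zero, ← smul_sub]
    rw [add_right_comm]
  · have hin : ∀ r ∈ Icc (0 : ℝ) 1, x + s • (t • v) + r • (t • w) ∈ A := fun r hr =>
      hAc.add_smul_mem (hin1 s hs) (by have := hin2 s hs; rwa [add_right_comm] at this) hr
    have key2 := sub_mem_of_hasDirDeriv
      (c := fun r => t⁻¹ • _root_.dirDeriv f (x + s • (t • v) + r • (t • w)) v)
      (c' := fun r => t⁻¹ • t • _root_.dirDeriv (fun y => _root_.dirDeriv f y v)
        (x + s • (t • v) + r • (t • w)) w) hCc hCcl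
      (fun r hr => (((hsm.hasDirDeriv (hAU (hin r hr)).2 w).smul t).comp_line).const_smul _)
      (fun r hr => by
        rw [inv_smul_smul₀ (show t ≠ 0 from ht)]
        exact (hAU (hin r hr)).1)
    convert key2 using 1
    simp only [one_smul, zero_smul, add_zero, ← smul_sub]
    rw [mul_smul, inv_smul_smul₀ (show t ≠ 0 from ht), add_right_comm]

end BastianiStability

/-! ### The closed graph theorem. -/

section ClosedGraph

variable {E : Type u} [AddCommGroup E] [Module ℝ E] [TopologicalSpace E]
  [IsTopologicalAddGroup E] [ContinuousSMul ℝ E]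
  {F : Type v} [AddCommGroup F] [Module ℝ F] [UniformSpace F]
  [IsUniformAddGroup F] [ContinuousSMul ℝ F]

/-- Linear maps on a Baire space are almost continuous. -/
theorem LinearMap.closure_preimage_mem_nhds_zero [BaireSpace E] (T : E →ₗ[ℝ] F) {V : Set F}
    (hV : V ∈ 𝓝 0) : closure (T ⁻¹' V) ∈ 𝓝 (0 : E) := by
  have hsub : Tendsto (fun p : F × F => p.1 - p.2) (𝓝 0 ×ˢ 𝓝 0) (𝓝 0) := by
    have : Continuous fun p : F × F => p.1 - p.2 := by fun_prop
    simpa [nhds_prod_eq] using this.tendsto (0, 0)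
  obtain ⟨V', hV', hVV⟩ := mem_prod_same_iff.1 (hsub hV)
  set D := closure (T ⁻¹' V') with hD
  -- The multiples (n + 1) • D cover E, so by Baire one of them has an interior point; rescaled, `D`
  -- is a neighbourhood of some point a, and D - a lies in D - D, which is contained in the closure
  -- of T⁻¹(V).
  let S : ℕ → Set E := fun n => (fun x => ((1 : ℝ) / ((n : ℝ) + 1)) • x) ⁻¹' D
  have hS : ∀ n, IsClosed (S n) := fun n => isClosed_closure.preimage (continuous_const_smul _)
  have hcov : ⋃ n, S n = univ := by
    refine eq_univ_of_forall fun x => mem_iUnion.2 ?_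
    have h0 : Tendsto (fun n : ℕ => ((1 : ℝ) / ((n : ℝ) + 1)) • T x) atTop (𝓝 0) := by
      simpa using (tendsto_one_div_add_atTop_nhds_zero_nat (𝕜 := ℝ)).smul_const (T x)
    obtain ⟨n, hn⟩ := (h0.eventually_mem hV').exists
    exact ⟨n, subset_closure (by rwa [mem_preimage, map_smul])⟩
  obtain ⟨n, x, hx⟩ := nonempty_interior_of_iUnion_of_closed hS hcov
  have hn : ((n : ℝ) + 1) ≠ 0 := by positivity
  set c : ℝ := (n : ℝ) + 1
  have hDx : D ∈ 𝓝 ((1 / c) • x) := by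
    have h1 : Tendsto (fun y : E => c • y) (𝓝 ((1 / c) • x)) (𝓝 x) := by
      have := (continuous_const_smul c).tendsto ((1 / c) • x : E)
      rwa [smul_smul, mul_one_div_cancel hn, one_smul] at this
    have h2 : (fun y : E => c • y) ⁻¹' S n ∈ 𝓝 ((1 / c) • x) := h1 (mem_interior_iff_mem_nhds.1 hx)
    convert h2 using 1
    ext y
    change y ∈ D ↔ (1 / c) • c • y ∈ D
    rw [smul_smul, one_div_mul_cancel hn, one_smul]
  have h3 : Tendsto (fun y : E => (1 / c) • x + y) (𝓝 0) (𝓝 ((1 / c) • x)) := by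
    have : Continuous fun y : E => (1 / c) • x + y := by fun_prop
    simpa using this.tendsto 0
  filter_upwards [h3 hDx] with y hy
  have hmem := map_mem_closure₂ (f := fun a b : E => a - b) (by fun_prop) hy
    (mem_of_mem_nhds hDx) (u := T ⁻¹' V) (fun a ha b hb => by
      have := hVV (mk_mem_prod ha hb)
      simpa using this)
  simpa using hmem

/-- The closed graph theorem for linear maps from a metrizable Baire space to a complete metrizable
space. -/
theorem LinearMap.continuous_of_tendsto_unique [BaireSpace E] [FirstCountableTopology E]
    [FirstCountableTopology F] [CompleteSpace F] (T : E →ₗ[ℝ] F)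
    (hT : ∀ (r : ℕ → E) (x : E) (y : F), Tendsto r atTop (𝓝 x) →
      Tendsto (fun n => T (r n)) atTop (𝓝 y) → y = T x) : Continuous T := by
  obtain ⟨A, hA, -⟩ := IsTopologicalAddGroup.exists_antitone_basis_nhds_zero E
  obtain ⟨V, hV, hVV⟩ := IsTopologicalAddGroup.exists_antitone_basis_nhds_zero F
  have hVm : ∀ n, V n ∈ 𝓝 (0 : F) := fun n => hV.1.mem_of_mem trivial
  have hAm : ∀ n, A n ∈ 𝓝 (0 : E) := fun n => hA.1.mem_of_mem trivial
  -- Successive approximation: subtracting from x a nearby point of T⁻¹(V n) leaves a small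
  -- remainder x' that is again a limit of points of T⁻¹(V (n + 1)).
  have step : ∀ (n : ℕ) (x : E), x ∈ closure (T ⁻¹' V n) →
      ∃ x', x' ∈ closure (T ⁻¹' V (n + 1)) ∧ x' ∈ A n ∧ T (x - x') ∈ V n := by
    intro n x hx
    have hN := inter_mem (T.closure_preimage_mem_nhds_zero (hVm (n + 1))) (hAm n)
    have h1 : Tendsto (fun y : E => x - y) (𝓝 x) (𝓝 0) := by
      have : Continuous fun y : E => x - y := by fun_prop
      simpa using this.tendsto x
    obtain ⟨y, hy, hyV⟩ := mem_closure_iff_nhds.1 hx _ (h1 hN)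
    exact ⟨x - y, hy.1, hy.2, by simpa using hyV⟩
  choose! nxt hn1 hn2 hn3 using step
  refine continuous_of_continuousAt_zero T ?_
  rw [ContinuousAt, map_zero]
  intro N hN
  obtain ⟨N', ⟨hN', hN'c⟩, hNN⟩ := (closed_nhds_basis (0 : F)).mem_iff.1 hN
  obtain ⟨k, -, hk⟩ := hV.1.mem_iff.1 hN'
  -- Since V (n + 1) + V (n + 1) ⊆ V n, starting at index k + 1 keeps the images of all partial sums
  -- x - r n in V k.
  refine mem_map.2 (mem_of_superset (T.closure_preimage_mem_nhds_zero (hVm (k + 1)))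
    fun x hx => hNN ?_)
  let r : ℕ → E := fun n => Nat.rec x (fun i z => nxt (i + (k + 1)) z) n
  have hr0 : r 0 = x := rfl
  have hrs : ∀ n, r (n + 1) = nxt (n + (k + 1)) (r n) := fun n => rfl
  have hr : ∀ n, r n ∈ closure (T ⁻¹' V (n + (k + 1))) := by
    intro n
    induction n with
    | zero => simpa [hr0] using hx
    | succ n ih =>
      rw [hrs, add_right_comm]
      exact hn1 _ _ ih
  have hrA : ∀ n, r (n + 1) ∈ A n := fun n =>
    hA.2 (Nat.le_add_right n (k + 1)) (hn2 _ _ (hr n))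
  have hrV : ∀ n, T (r n - r (n + 1)) ∈ V (n + k + 1) := fun n => hn3 _ _ (hr n)
  have hr_lim : Tendsto r atTop (𝓝 0) :=
    (tendsto_add_atTop_iff_nat 1).1 (hA.tendsto hrA)
  have hsum : ∀ j n, T (r n - r (n + j)) ∈ V (n + k) := by
    intro j
    induction j with
    | zero => intro n; simpa using mem_of_mem_nhds (hVm (n + k))
    | succ j ih =>
      intro n
      have e : T (r n - r (n + (j + 1))) = T (r n - r (n + 1)) + T (r (n + 1) - r (n + 1 + j)) := by
        rw [← map_add, sub_add_sub_cancel, add_assoc, add_comm 1 j]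
      rw [e]
      refine hVV _ (add_mem_add (hrV n) ?_)
      have := ih (n + 1)
      rwa [add_right_comm] at this
  have hcauchy : CauchySeq fun n => T (x - r n) := by
    refine (hV.1.uniformity_of_nhds_zero_swapped.cauchySeq_iff').2 fun i _ => ⟨i, fun n hn => ?_⟩
    obtain ⟨j, rfl⟩ := Nat.exists_eq_add_of_le hn
    simp only [mem_ofPred_eq, ← map_sub, sub_sub_sub_cancel_left]
    exact hV.2 (Nat.le_add_right i k) (hsum j i)
  obtain ⟨y, hy⟩ := cauchySeq_tendsto_of_complete hcauchy
  -- The partial sums tend to x and their images to y; only here is the closed graph used.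
  have hyT : y = T x := hT (fun n => x - r n) x y (by simpa using hr_lim.const_sub x) hy
  rw [← hyT]
  refine hN'c.mem_of_tendsto hy (Eventually.of_forall fun n => hk ?_)
  have := hsum n 0
  simpa [hr0] using this

end ClosedGraph

/-! ### From separate to joint smoothness on barrelled metrizable spaces. -/

section SeparateSmoothness

variable {E : Type u} [AddCommGroup E] [Module ℝ E] [TopologicalSpace E]
  [IsTopologicalAddGroup E] [ContinuousSMul ℝ E] [LocallyConvexSpace ℝ E] [T2Space E]
  {F : Type v} [AddCommGroup F] [Module ℝ F] [TopologicalSpace F]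
  [IsTopologicalAddGroup F] [ContinuousSMul ℝ F] [LocallyConvexSpace ℝ F] [T2Space F]
  {P : Type w} [AddCommGroup P] [Module ℝ P] [TopologicalSpace P]
  [IsTopologicalAddGroup P] [ContinuousSMul ℝ P] [LocallyConvexSpace ℝ P] [T2Space P]

/-- A pointwise convergent sequence of continuous linear maps on a barrelled space converges along
convergent sequences of arguments. -/
theorem ContinuousLinearMap.tendsto_apply_of_pointwise [BarrelledSpace ℝ E]
    {L : ℕ → E →L[ℝ] F} {L₀ : E →L[ℝ] F} (hL : ∀ v, Tendsto (fun n => L n v) atTop (𝓝 (L₀ v)))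
    {a : ℕ → E} {v : E} (ha : Tendsto a atTop (𝓝 v)) :
    Tendsto (fun n => L n (a n)) atTop (𝓝 (L₀ v)) := by
  let _ := IsTopologicalAddGroup.rightUniformSpace E
  let _ := IsTopologicalAddGroup.rightUniformSpace F
  have : IsUniformAddGroup E := isUniformAddGroup_of_addCommGroup
  have : IsUniformAddGroup F := isUniformAddGroup_of_addCommGroup
  have heq : UniformEquicontinuous ((↑) ∘ L : ℕ → E → F) :=
    PolynormableSpace.banach_steinhaus fun v => (hL v).isVonNBounded_range ℝ
  have h0 : Tendsto (fun n => L n (a n - v)) atTop (𝓝 0) := by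
    rw [tendsto_iff_comap, nhds_eq_comap_uniformity, comap_comap, ← tendsto_iff_comap]
    intro W hW
    have h1 := heq.equicontinuous 0 W hW
    have h2 : Tendsto (fun n => a n - v) atTop (𝓝 0) := by simpa using ha.sub_const v
    refine mem_map.2 ?_
    filter_upwards [h2.eventually h1] with n hn
    simpa using hn n
  simpa using h0.add (hL v)

/-- First countability reduces the claim to sequences (yₙ, vₙ). The maps f(yₙ, ·) converge
pointwise, and Banach–Steinhaus allows the argument to move as well. -/
theorem continuousOn_of_separately [BarrelledSpace ℝ E] [FirstCountableTopology E]
    [FirstCountableTopology P] {f : P × E → F} {U : Set P}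
    (h1 : ∀ v, ContinuousOn (fun y => f (y, v)) U)
    (h2 : ∀ y ∈ U, ∃ L : E →L[ℝ] F, ∀ v, f (y, v) = L v) : ContinuousOn f (U ×ˢ univ) := by
  choose! L hL using h2
  rintro ⟨y, v⟩ ⟨hy, -⟩
  refine tendsto_of_seq_tendsto fun z hz => ?_
  obtain ⟨hz1, hz2⟩ := tendsto_nhdsWithin_iff.1 hz
  obtain ⟨hzy, hzv⟩ := Prod.tendsto_iff _ _ |>.1 hz1
  have hlim : ∀ x, Tendsto (fun n => L (z n).1 x) atTop (𝓝 (L y x)) := fun x => by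
    have : Tendsto (fun n => f ((z n).1, x)) atTop (𝓝 (f (y, x))) :=
      (h1 x y hy).tendsto.comp (tendsto_nhdsWithin_iff.2 ⟨hzy, hz2.mono fun n hn => hn.1⟩)
    rw [hL y hy] at this
    refine this.congr' ?_
    filter_upwards [hz2] with n hn
    exact hL _ hn.1 x
  have := ContinuousLinearMap.tendsto_apply_of_pointwise hlim hzv
  rw [← hL y hy] at this
  refine this.congr' ?_
  filter_upwards [hz2] with n hn
  exact (hL _ hn.1 _).symm

/-- A pointwise limit of difference quotients, which are continuous linear in v, is continuous
linear on a barrelled space. Thus the partial derivative satisfies the hypotheses of the smoothness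
theorem below again. -/
theorem exists_clm_dirDeriv [BarrelledSpace ℝ E] {f : P × E → F} {U : Set P} (hU : IsOpen U)
    (h1 : ∀ v, BastianiSmoothOn (fun y => f (y, v)) U)
    (h2 : ∀ y ∈ U, ∃ L : E →L[ℝ] F, ∀ v, f (y, v) = L v) {y : P} (hy : y ∈ U) (h : P) :
    ∃ L : E →L[ℝ] F, ∀ v, dirDeriv (fun y => f (y, v)) y h = L v := by
  choose! L hL using h2
  let _ := IsTopologicalAddGroup.rightUniformSpace E
  let _ := IsTopologicalAddGroup.rightUniformSpace F
  have : IsUniformAddGroup E := isUniformAddGroup_of_addCommGroup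
  have : IsUniformAddGroup F := isUniformAddGroup_of_addCommGroup
  have hlim : Tendsto (fun (t : ℝ) (v : E) => (t⁻¹ • (L (y + t • h) - L y)) v) (𝓝[≠] 0)
      (𝓝 fun v => dirDeriv (fun y => f (y, v)) y h) := by
    refine tendsto_pi_nhds.2 fun v => ?_
    refine Tendsto.congr' ?_ ((h1 v).hasDirDeriv hy h)
    filter_upwards [(tendsto_add_smul_punctured y h).eventually (hU.mem_nhds hy)] with t ht
    simp [hL _ ht, hL _ hy]
  exact ⟨continuousLinearMapOfTendsto _ hlim, fun v => rfl⟩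

/-- On a barrelled metrizable space, a map that is smooth in the first variable and continuous
linear in the second one is smooth. -/
theorem bastianiSmoothOn_of_separately [BarrelledSpace ℝ E] [FirstCountableTopology E]
    [FirstCountableTopology P] {f : P × E → F} {U : Set P} (hU : IsOpen U)
    (h1 : ∀ v, BastianiSmoothOn (fun y => f (y, v)) U)
    (h2 : ∀ y ∈ U, ∃ L : E →L[ℝ] F, ∀ v, f (y, v) = L v) : BastianiSmoothOn f (U ×ˢ univ) := by
  intro n
  induction n generalizing P with
  | zero => exact continuousOn_of_separately (fun v => h1 v 0) h2
  | succ n ih =>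
    -- Both summands are smooth in a parameter and continuous linear in a vector: the first with
    -- parameter (y, h) in P × P, the second being f itself. The induction hypothesis covers both.
    have hd : ∀ y ∈ U, ∀ v h k, HasDirDeriv f (y, v) (h, k)
        (dirDeriv (fun y => f (y, v)) y h + f (y, k)) := by
      intro y hy v h k
      have hc := ((h1 k 0).continuousAt (hU.mem_nhds hy)).tendsto.comp
        (tendsto_add_smul_punctured y h)
      refine (Tendsto.add ((h1 v).hasDirDeriv hy h) hc).congr' ?_
      filter_upwards [(tendsto_add_smul_punctured y h).eventually (hU.mem_nhds hy),
        self_mem_nhdsWithin] with t ht ht0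
      obtain ⟨L, hL⟩ := h2 _ ht
      have ht0 : t ≠ 0 := ht0
      simp only [Function.comp, Prod.smul_mk, Prod.mk_add_mk, hL, map_add, map_smul]
      rw [add_sub_right_comm, smul_add, inv_smul_smul₀ ht0]
    have hO := hU.prod (isOpen_univ (X := E))
    have hO2 := hO.prod (isOpen_univ (X := P × E))
    refine ⟨continuousOn_of_separately (fun v => h1 v 0) h2, ?_, ?_⟩
    · rintro ⟨y, v⟩ ⟨hy, -⟩ ⟨h, k⟩
      exact ⟨_, hd y hy v h k⟩
    · have s1 : BastianiCOn n
          (fun z : (P × P) × E => dirDeriv (fun y => f (y, z.2)) z.1.1 z.1.2)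
          ((U ×ˢ univ) ×ˢ univ) :=
        ih (hU.prod isOpen_univ) (fun v => (h1 v).dirDeriv)
          (fun z hz => exists_clm_dirDeriv hU h1 h2 hz.1 z.2)
      have s2 : BastianiCOn n f (U ×ˢ univ) := ih hU h1 h2
      let fs := ContinuousLinearMap.fst ℝ (P × E) (P × E)
      let sn := ContinuousLinearMap.snd ℝ (P × E) (P × E)
      let p := ContinuousLinearMap.fst ℝ P E
      let q := ContinuousLinearMap.snd ℝ P E
      have t1 := s1.comp_clm (((p.comp fs).prod (p.comp sn)).prod (q.comp fs)) hO2
        (fun z hz => ⟨⟨hz.1.1, trivial⟩, trivial⟩)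
      have t2 := s2.comp_clm ((p.comp fs).prod (q.comp sn)) hO2 (fun z hz => ⟨hz.1.1, trivial⟩)
      have t3 := ((ContinuousLinearMap.fst ℝ F F + ContinuousLinearMap.snd ℝ F F).bastianiCOn n
        univ).comp (t1.prodMk hO2 t2) isOpen_univ hO2 (mapsTo_univ _ _)
      refine t3.congr hO2 ?_
      rintro ⟨⟨y, v⟩, h, k⟩ ⟨⟨hy, -⟩, -⟩
      exact (hd y hy v h k).dirDeriv_eq.symm

end SeparateSmoothness

/-! ### Vector fields, Lie brackets and derivatives of functions under changes of charts. -/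

section ChartChange

variable {E : Type u} [AddCommGroup E] [Module ℝ E] [TopologicalSpace E]
  [IsTopologicalAddGroup E] [ContinuousSMul ℝ E] [LocallyConvexSpace ℝ E] [T2Space E]
  {M : Type w} [TopologicalSpace M] [ChartedSpace E M]

/-- The change of coordinates of tangent vectors at `p` from the chart `e` to the chart `f`. -/
noncomputable def tangentChange (e f : OpenPartialHomeomorph M E) (p : M) (v : E) : E :=
  dirDeriv (fun y => f (e.symm y)) (e p) v

/-- The vector field on the domain of the chart `e` with constant coordinates `v`. -/
noncomputable def constVF (e : OpenPartialHomeomorph M E) (v : E) (p : M) : TVec E p :=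
  tangentChange e (chartAt E p) p v

theorem tvec_eq_constVF {e : OpenPartialHomeomorph M E} {y : E} (hy : y ∈ e.target) (v : E) :
    tvec e y v = constVF e v (e.symm y) := by
  rw [constVF, tangentChange, e.right_inv hy]
  rfl

theorem localRep_apply {e : OpenPartialHomeomorph M E} {p : M} (hp : p ∈ e.source)
    (X : ∀ p : M, TVec E p) :
    localRep e X (e p) = tangentChange (chartAt E p) e p (X p) := by
  rw [localRep, e.left_inv hp]
  rfl

theorem isOpen_transition (e f : OpenPartialHomeomorph M E) :
    IsOpen (e.target ∩ e.symm ⁻¹' f.source) :=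
  e.isOpen_inter_preimage_symm f.open_source

theorem isOpen_chartImage (e : OpenPartialHomeomorph M E) (U : Opens M) :
    IsOpen (chartImage e U) :=
  e.isOpen_inter_preimage_symm U.isOpen

theorem mem_transition {e f : OpenPartialHomeomorph M E} {p : M} (he : p ∈ e.source)
    (hf : p ∈ f.source) : e p ∈ e.target ∩ e.symm ⁻¹' f.source :=
  ⟨e.map_source he, by rwa [mem_preimage, e.left_inv he]⟩

theorem mem_chartImage {e : OpenPartialHomeomorph M E} {U : Opens M} {p : M} (he : p ∈ e.source)
    (hU : p ∈ U) : e p ∈ chartImage e U :=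
  ⟨e.map_source he, by rwa [mem_preimage, e.left_inv he]⟩

theorem tangentChange_self {e : OpenPartialHomeomorph M E} {p : M} (he : p ∈ e.source) (v : E) :
    tangentChange e e p v = v := by
  have h : (fun y => e (e.symm y)) =ᶠ[𝓝 (e p)] fun y => y :=
    mem_of_superset (e.open_target.mem_nhds (e.map_source he)) fun y hy => e.right_inv hy
  rw [tangentChange, dirDeriv_congr h]
  exact (hasDirDeriv_id _ v).dirDeriv_eq

variable [BastianiManifold E M]

theorem transition_smooth {e f : OpenPartialHomeomorph M E} (he : e ∈ atlas E M)
    (hf : f ∈ atlas E M) :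
    BastianiSmoothOn (fun y => f (e.symm y)) (e.target ∩ e.symm ⁻¹' f.source) :=
  BastianiManifold.smooth_change e he f hf

theorem hasDirDeriv_transition {e f : OpenPartialHomeomorph M E} (he : e ∈ atlas E M)
    (hf : f ∈ atlas E M) {p : M} (hpe : p ∈ e.source) (hpf : p ∈ f.source) (v : E) :
    HasDirDeriv (fun y => f (e.symm y)) (e p) v (tangentChange e f p v) :=
  (transition_smooth he hf).hasDirDeriv (mem_transition hpe hpf) v

theorem tangentChange_add {e f : OpenPartialHomeomorph M E} (he : e ∈ atlas E M)
    (hf : f ∈ atlas E M) {p : M} (hpe : p ∈ e.source) (hpf : p ∈ f.source) (v w : E) :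
    tangentChange e f p (v + w) = tangentChange e f p v + tangentChange e f p w :=
  (transition_smooth he hf).dirDeriv_add (isOpen_transition e f) (mem_transition hpe hpf) v w

theorem tangentChange_smul {e f : OpenPartialHomeomorph M E} (he : e ∈ atlas E M)
    (hf : f ∈ atlas E M) {p : M} (hpe : p ∈ e.source) (hpf : p ∈ f.source) (r : ℝ) (v : E) :
    tangentChange e f p (r • v) = r • tangentChange e f p v :=
  (transition_smooth he hf).dirDeriv_smul (mem_transition hpe hpf) r v

theorem tangentChange_neg {e f : OpenPartialHomeomorph M E} (he : e ∈ atlas E M)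
    (hf : f ∈ atlas E M) {p : M} (hpe : p ∈ e.source) (hpf : p ∈ f.source) (v : E) :
    tangentChange e f p (-v) = -tangentChange e f p v := by
  simpa using tangentChange_smul he hf hpe hpf (-1) v

theorem tangentChange_sub {e f : OpenPartialHomeomorph M E} (he : e ∈ atlas E M)
    (hf : f ∈ atlas E M) {p : M} (hpe : p ∈ e.source) (hpf : p ∈ f.source) (v w : E) :
    tangentChange e f p (v - w) = tangentChange e f p v - tangentChange e f p w := by
  rw [sub_eq_add_neg, tangentChange_add he hf hpe hpf, tangentChange_neg he hf hpe hpf,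
    sub_eq_add_neg]

/-- Composition with a change of charts does not change a function near the base point. -/
theorem comp_transition_eventuallyEq {α : Type*} {e f : OpenPartialHomeomorph M E} {p : M}
    (hpe : p ∈ e.source) (hpf : p ∈ f.source) (φ : M → α) :
    (fun x => φ (e.symm (e (f.symm x)))) =ᶠ[𝓝 (f p)] fun x => φ (f.symm x) :=
  mem_of_superset ((isOpen_transition f e).mem_nhds (mem_transition hpf hpe)) fun x hx => by
    change φ (e.symm (e (f.symm x))) = φ (f.symm x)
    rw [e.left_inv hx.2]

theorem tangentChange_tangentChange {e f h : OpenPartialHomeomorph M E} (he : e ∈ atlas E M)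
    (hf : f ∈ atlas E M) (hh : h ∈ atlas E M) {p : M} (hpe : p ∈ e.source) (hpf : p ∈ f.source)
    (hph : p ∈ h.source) (v : E) :
    tangentChange f h p (tangentChange e f p v) = tangentChange e h p v := by
  have h1 := (transition_smooth hf hh).dirDeriv_comp (isOpen_transition f h)
    (f := fun y => f (e.symm y)) (x := e p) (v := v)
    (by rw [e.left_inv hpe]; exact mem_transition hpf hph)
    (hasDirDeriv_transition he hf hpe hpf v)
  rw [dirDeriv_congr (comp_transition_eventuallyEq hpf hpe h)] at h1
  rw [tangentChange, tangentChange, tangentChange, h1, e.left_inv hpe]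
  rfl

theorem tangentChange_inv {e f : OpenPartialHomeomorph M E} (he : e ∈ atlas E M)
    (hf : f ∈ atlas E M) {p : M} (hpe : p ∈ e.source) (hpf : p ∈ f.source) (v : E) :
    tangentChange f e p (tangentChange e f p v) = v := by
  rw [tangentChange_tangentChange he hf he hpe hpf hpe, tangentChange_self hpe]

theorem constVF_add {e : OpenPartialHomeomorph M E} (he : e ∈ atlas E M) {p : M}
    (hpe : p ∈ e.source) (v w : E) : constVF e (v + w) p = constVF e v p + constVF e w p :=
  tangentChange_add he (chart_mem_atlas E p) hpe (mem_chart_source E p) v w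

theorem constVF_smul {e : OpenPartialHomeomorph M E} (he : e ∈ atlas E M) {p : M}
    (hpe : p ∈ e.source) (r : ℝ) (v : E) : constVF e (r • v) p = r • constVF e v p :=
  tangentChange_smul he (chart_mem_atlas E p) hpe (mem_chart_source E p) r v

theorem localRep_constVF_apply {e f : OpenPartialHomeomorph M E} (he : e ∈ atlas E M)
    (hf : f ∈ atlas E M) {p : M} (hpe : p ∈ e.source) (hpf : p ∈ f.source) (v : E) :
    localRep f (constVF e v) (f p) = tangentChange e f p v := by
  rw [localRep_apply hpf]
  exact tangentChange_tangentChange he (chart_mem_atlas E p) hf hpe (mem_chart_source E p) hpf v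

theorem constVF_localRep {e : OpenPartialHomeomorph M E} (he : e ∈ atlas E M) {p : M}
    (hpe : p ∈ e.source) (X : ∀ p : M, TVec E p) : constVF e (localRep e X (e p)) p = X p := by
  rw [localRep_apply hpe]
  exact tangentChange_inv (chart_mem_atlas E p) he (mem_chart_source E p) hpe (X p)

theorem localRep_change {e f : OpenPartialHomeomorph M E} (he : e ∈ atlas E M)
    (hf : f ∈ atlas E M) {p : M} (hpe : p ∈ e.source) (hpf : p ∈ f.source)
    (X : ∀ p : M, TVec E p) :
    localRep f X (f p) = tangentChange e f p (localRep e X (e p)) := by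
  rw [localRep_apply hpf, localRep_apply hpe]
  exact (tangentChange_tangentChange (chart_mem_atlas E p) he hf (mem_chart_source E p) hpe hpf
    (X p)).symm

/-- The domain of a chart. -/
def chartOpens (e : OpenPartialHomeomorph M E) : Opens M := ⟨e.source, e.open_source⟩

/-- In a chart f the family is (v, x) ↦ dσ(σ⁻¹(x); v) with σ = f ∘ e⁻¹, smooth in both variables.
The parameter v makes the condition on smooth families applicable to constant fields. -/
theorem isSmoothFamily_constVF {e : OpenPartialHomeomorph M E} (he : e ∈ atlas E M)
    {U : Opens M} (hU : U ≤ chartOpens e) : IsSmoothFamily U (constVF e) := by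
  intro f hf
  have hO : IsOpen ((univ : Set E) ×ˢ chartImage f U) := isOpen_univ.prod (isOpen_chartImage f U)
  have h1 : BastianiSmoothOn (fun z : E × E => (e (f.symm z.2), z.1))
      (univ ×ˢ chartImage f U) :=
    ((transition_smooth hf he).comp_clm (ContinuousLinearMap.snd ℝ E E) hO
      (fun z hz => ⟨hz.2.1, hU hz.2.2⟩)).prodMk
      ((ContinuousLinearMap.fst ℝ E E).bastianiSmoothOn _) hO
  refine ((transition_smooth he hf).dirDeriv.comp h1
    ((isOpen_transition e f).prod isOpen_univ) hO (fun z hz =>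
      ⟨mem_transition (hU hz.2.2) (f.map_target hz.2.1), trivial⟩)).congr hO ?_
  rintro ⟨v, x⟩ ⟨-, hx, hxU⟩
  have := localRep_constVF_apply he hf (hU hxU) (f.map_target hx) v
  rw [f.right_inv hx] at this
  exact this.symm

theorem IsSmoothFamily.isSmoothVF {U : Opens M} {X : E → ∀ p : M, TVec E p}
    (hX : IsSmoothFamily U X) (v : E) : IsSmoothVF U (X v) := by
  intro f hf
  have hO := isOpen_chartImage f U
  exact (hX f hf).comp (f := fun x => (v, x)) ((bastianiSmoothOn_const v _).prodMk
    ((ContinuousLinearMap.id ℝ E).bastianiSmoothOn _) hO) (isOpen_univ.prod hO) hO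
    (fun x hx => ⟨trivial, hx⟩)

theorem isSmoothVF_constVF {e : OpenPartialHomeomorph M E} (he : e ∈ atlas E M)
    {U : Opens M} (hU : U ≤ chartOpens e) (v : E) : IsSmoothVF U (constVF e v) :=
  (isSmoothFamily_constVF he hU).isSmoothVF v

theorem localRep_constVF_self {e : OpenPartialHomeomorph M E} (he : e ∈ atlas E M) (v : E)
    {y : E} (hy : y ∈ e.target) : localRep e (constVF e v) y = v := by
  have h := localRep_constVF_apply he he (e.map_target hy) (e.map_target hy) v
  rwa [e.right_inv hy, tangentChange_self (e.map_target hy)] at h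

theorem dirDeriv_localRep_constVF {e : OpenPartialHomeomorph M E} (he : e ∈ atlas E M) (v : E)
    {y : E} (hy : y ∈ e.target) (k : E) : dirDeriv (localRep e (constVF e v)) y k = 0 := by
  have h : localRep e (constVF e v) =ᶠ[𝓝 y] fun _ => v :=
    mem_of_superset (e.open_target.mem_nhds hy) fun x hx => localRep_constVF_self he v hx
  rw [dirDeriv_congr h]
  exact (hasDirDeriv_const v y k).dirDeriv_eq

/-- The derivatives of the local representatives of a vector field in two charts. -/
theorem dirDeriv_localRep_change {e f : OpenPartialHomeomorph M E} (he : e ∈ atlas E M)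
    (hf : f ∈ atlas E M) {U : Opens M} {X : ∀ p : M, TVec E p} (hX : IsSmoothVF U X) {p : M}
    (hpU : p ∈ U) (hpe : p ∈ e.source) (hpf : p ∈ f.source) (k : E) :
    dirDeriv (localRep f X) (f p) (tangentChange e f p k) =
      dirDeriv (fun y => dirDeriv (fun y => f (e.symm y)) y (localRep e X (e p))) (e p) k +
        tangentChange e f p (dirDeriv (localRep e X) (e p) k) := by
  have hσ := transition_smooth he hf
  have hT := mem_transition hpe hpf
  have hXe : HasDirDeriv (fun y => (y, localRep e X y)) (e p) k
      (k, dirDeriv (localRep e X) (e p) k) :=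
    (hasDirDeriv_id _ k).prodMk ((hX e he).hasDirDeriv (mem_chartImage hpe hpU) k)
  have h1 := hσ.dirDeriv.dirDeriv_comp ((isOpen_transition e f).prod isOpen_univ)
    (f := fun y => (y, localRep e X y)) (x := e p) (v := k) ⟨hT, trivial⟩ hXe
  rw [hσ.dirDeriv_fst_snd (isOpen_transition e f) hT] at h1
  rw [tangentChange, tangentChange, ← h1]
  -- With σ = f ∘ e⁻¹, the rule X_f(σ(y)) = dσ(y; X_e(y)) is differentiated along k: `h1` treats the
  -- right side, `h3` the left.
  have h2 : (fun y => localRep f X (f (e.symm y))) =ᶠ[𝓝 (e p)]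
      fun y => dirDeriv (fun y => f (e.symm y)) y (localRep e X y) := by
    refine mem_of_superset ((isOpen_transition e f).mem_nhds hT) fun y hy => ?_
    have := localRep_change he hf (e.map_target hy.1) hy.2 X
    rwa [tangentChange, e.right_inv hy.1] at this
  rw [← dirDeriv_congr h2]
  have h3 := (hX f hf).dirDeriv_comp (isOpen_chartImage f U) (f := fun y => f (e.symm y))
    (x := e p) (v := k) (by rw [e.left_inv hpe]; exact mem_chartImage hpf hpU)
    (hasDirDeriv_transition he hf hpe hpf k)
  rw [h3, e.left_inv hpe]
  rfl

/-- The Lie bracket in an arbitrary chart. -/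
theorem localRep_lieBracketVF {e : OpenPartialHomeomorph M E} (he : e ∈ atlas E M)
    {U : Opens M} {X Y : ∀ p : M, TVec E p} (hX : IsSmoothVF U X) (hY : IsSmoothVF U Y) {p : M}
    (hpU : p ∈ U) (hpe : p ∈ e.source) :
    localRep e (lieBracketVF X Y) (e p) =
      dirDeriv (localRep e Y) (e p) (localRep e X (e p)) -
        dirDeriv (localRep e X) (e p) (localRep e Y (e p)) := by
  have hf := chart_mem_atlas E p
  have hpf := mem_chart_source E p
  have hx : tangentChange e (chartAt E p) p (localRep e X (e p)) = X p := constVF_localRep he hpe X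
  have hy : tangentChange e (chartAt E p) p (localRep e Y (e p)) = Y p := constVF_localRep he hpe Y
  -- The second derivatives of the change of charts cancel by their symmetry.
  rw [localRep_apply hpe, lieBracketVF, ← hx, ← hy,
    dirDeriv_localRep_change he hf hX hpU hpe hpf, dirDeriv_localRep_change he hf hY hpU hpe hpf,
    (transition_smooth he hf).dirDeriv_comm (isOpen_transition e _) (mem_transition hpe hpf),
    add_sub_add_left_eq_sub, ← tangentChange_sub he hf hpe hpf, tangentChange_inv he hf hpe hpf]

/-- The derivative of a function along a vector field in an arbitrary chart. -/
theorem derivAlong_eq {e : OpenPartialHomeomorph M E} (he : e ∈ atlas E M)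
    {U : Opens M} {φ : M → ℝ} (hφ : BastianiSmoothOn (fun y => φ (e.symm y)) (chartImage e U))
    (X : ∀ p : M, TVec E p) {p : M} (hpU : p ∈ U) (hpe : p ∈ e.source) :
    derivAlong X φ p = dirDeriv (fun y => φ (e.symm y)) (e p) (localRep e X (e p)) := by
  have hf := chart_mem_atlas E p
  have hpf := mem_chart_source E p
  have h1 := hφ.dirDeriv_comp (isOpen_chartImage e U) (f := fun x => e ((chartAt E p).symm x))
    (x := chartAt E p p) (v := X p)
    (by rw [(chartAt E p).left_inv hpf]; exact mem_chartImage hpe hpU)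
    (hasDirDeriv_transition hf he hpf hpe (X p))
  rw [dirDeriv_congr (comp_transition_eventuallyEq hpe hpf φ), (chartAt E p).left_inv hpf] at h1
  rw [derivAlong, h1, localRep_apply hpe]

end ChartChange

/-! ### Calculus of the local metric and the Koszul formula. -/

section Koszul

variable {E : Type u} [AddCommGroup E] [Module ℝ E] [TopologicalSpace E]
  [IsTopologicalAddGroup E] [ContinuousSMul ℝ E] [LocallyConvexSpace ℝ E] [T2Space E]
  {M : Type w} [TopologicalSpace M] [ChartedSpace E M] [BastianiManifold E M]

namespace WeakRiemannianMetric

variable (g : WeakRiemannianMetric E M)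

theorem localRep_apply {e : OpenPartialHomeomorph M E} {p : M} (hp : p ∈ e.source) (v w : E) :
    g.localRep e (e p) v w = g.val p (constVF e v p) (constVF e w p) := by
  rw [localRep, tvec_eq_constVF (e.map_source hp), tvec_eq_constVF (e.map_source hp),
    e.left_inv hp]

theorem val_eq_localRep {e : OpenPartialHomeomorph M E} (he : e ∈ atlas E M) {p : M}
    (hp : p ∈ e.source) (X Y : ∀ p : M, TVec E p) :
    g.val p (X p) (Y p) =
      g.localRep e (e p) (_root_.localRep e X (e p)) (_root_.localRep e Y (e p)) := by
  rw [g.localRep_apply hp, constVF_localRep he hp, constVF_localRep he hp]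

theorem localRep_symm (e : OpenPartialHomeomorph M E) (y v w : E) :
    g.localRep e y v w = g.localRep e y w v :=
  g.symm _ _ _

theorem localRep_add_left {e : OpenPartialHomeomorph M E} (he : e ∈ atlas E M) {y : E}
    (hy : y ∈ e.target) (v v' w : E) :
    g.localRep e y (v + v') w = g.localRep e y v w + g.localRep e y v' w := by
  simp only [localRep, tvec_eq_constVF hy]
  rw [constVF_add he (e.map_target hy), map_add, LinearMap.add_apply]

theorem localRep_smul_left {e : OpenPartialHomeomorph M E} (he : e ∈ atlas E M) {y : E}
    (hy : y ∈ e.target) (r : ℝ) (v w : E) :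
    g.localRep e y (r • v) w = r * g.localRep e y v w := by
  simp only [localRep, tvec_eq_constVF hy]
  rw [constVF_smul he (e.map_target hy), map_smul, LinearMap.smul_apply, smul_eq_mul]

theorem localRep_add_right {e : OpenPartialHomeomorph M E} (he : e ∈ atlas E M) {y : E}
    (hy : y ∈ e.target) (v w w' : E) :
    g.localRep e y v (w + w') = g.localRep e y v w + g.localRep e y v w' := by
  simp only [g.localRep_symm e y v, g.localRep_add_left he hy]

theorem localRep_smul_right {e : OpenPartialHomeomorph M E} (he : e ∈ atlas E M) {y : E}
    (hy : y ∈ e.target) (r : ℝ) (v w : E) :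
    g.localRep e y v (r • w) = r * g.localRep e y v w := by
  simp only [g.localRep_symm e y v, g.localRep_smul_left he hy]

theorem localRep_neg_left {e : OpenPartialHomeomorph M E} (he : e ∈ atlas E M) {y : E}
    (hy : y ∈ e.target) (v w : E) : g.localRep e y (-v) w = -g.localRep e y v w := by
  simpa using g.localRep_smul_left he hy (-1) v w

theorem localRep_neg_right {e : OpenPartialHomeomorph M E} (he : e ∈ atlas E M) {y : E}
    (hy : y ∈ e.target) (v w : E) : g.localRep e y v (-w) = -g.localRep e y v w := by
  simpa using g.localRep_smul_right he hy (-1) v w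

/-- Definiteness of g, carried to the chart by the injectivity of coordinate changes. Identities
between Christoffel symbols are proved by testing them against all z. -/
theorem eq_of_localRep_eq {e : OpenPartialHomeomorph M E} (he : e ∈ atlas E M) {y : E}
    (hy : y ∈ e.target) {v w : E} (h : ∀ z, g.localRep e y v z = g.localRep e y w z) : v = w := by
  have h0 : g.localRep e y (v + -w) (v + -w) = 0 := by
    rw [g.localRep_add_left he hy, g.localRep_neg_left he hy, h, add_neg_cancel]
  have h1 := g.definite _ _ h0
  have hp := e.map_target hy
  have h2 : v + -w = 0 := by
    have h3 := tangentChange_inv he (chart_mem_atlas E (e.symm y)) hp (mem_chart_source E _)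
      (v + -w)
    rw [tvec_eq_constVF hy] at h1
    change tangentChange e (chartAt E (e.symm y)) (e.symm y) (v + -w) = 0 at h1
    rw [h1] at h3
    rw [← h3]
    simpa using tangentChange_smul (chart_mem_atlas E (e.symm y)) he (mem_chart_source E _) hp 0
      (0 : E)
  exact add_neg_eq_zero.1 h2

theorem smooth_localRep {e : OpenPartialHomeomorph M E} (he : e ∈ atlas E M) :
    BastianiSmoothOn (fun z : E × E × E => g.localRep e z.1 z.2.1 z.2.2) (e.target ×ˢ univ) :=
  g.smooth e he

theorem continuous_localRep {e : OpenPartialHomeomorph M E} (he : e ∈ atlas E M) {y : E}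
    (hy : y ∈ e.target) (w : E) : Continuous fun v => g.localRep e y v w :=
  (g.smooth_localRep he 0).continuousOn.comp_continuous (f := fun v : E => (y, v, w))
    (by fun_prop) (fun _ => ⟨hy, trivial⟩)

/-- The derivative `d₁g_U(y, v, w; a)`. -/
noncomputable def dOne (e : OpenPartialHomeomorph M E) (y a v w : E) : ℝ :=
  dirDeriv (fun x => g.localRep e x v w) y a

theorem dOne_symm (e : OpenPartialHomeomorph M E) (y a v w : E) :
    g.dOne e y a v w = g.dOne e y a w v := by
  simp only [dOne, g.localRep_symm e _ v w]

theorem smooth_localRep_const {e : OpenPartialHomeomorph M E} (he : e ∈ atlas E M) (v w : E) :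
    BastianiSmoothOn (fun x => g.localRep e x v w) e.target :=
  (g.smooth_localRep he).comp (f := fun x => (x, v, w))
    (((ContinuousLinearMap.id ℝ E).bastianiSmoothOn _).prodMk (bastianiSmoothOn_const (v, w) _)
      e.open_target) (e.open_target.prod isOpen_univ) e.open_target (fun _ hx => ⟨hx, trivial⟩)

/-- Seen as a value of the total derivative, d₁g is jointly continuous in direction and arguments.
-/
theorem dOne_eq {e : OpenPartialHomeomorph M E} (he : e ∈ atlas E M) {y : E}
    (hy : y ∈ e.target) (a v w : E) :
    g.dOne e y a v w =
      dirDeriv (fun z : E × E × E => g.localRep e z.1 z.2.1 z.2.2) (y, v, w) (a, 0, 0) :=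
  (g.smooth_localRep he).dirDeriv_comp (e.open_target.prod isOpen_univ)
    (f := fun x => (x, v, w)) (x := y) (v := a) ⟨hy, trivial⟩
    ((hasDirDeriv_id y a).prodMk (hasDirDeriv_const (v, w) y a))

theorem hasDirDeriv_localRep {e : OpenPartialHomeomorph M E} (he : e ∈ atlas E M) {y : E}
    (hy : y ∈ e.target) {b c : E → E} {a b' c' : E} (hb : HasDirDeriv b y a b')
    (hc : HasDirDeriv c y a c') :
    HasDirDeriv (fun x => g.localRep e x (b x) (c x)) y a
      (g.dOne e y a (b y) (c y) + g.localRep e y b' (c y) + g.localRep e y (b y) c') := by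
  have hO := e.open_target.prod (isOpen_univ (X := E × E))
  have hG := g.smooth_localRep he
  have hm : ((y, b y, c y) : E × E × E) ∈ e.target ×ˢ univ := ⟨hy, trivial⟩
  have h1 := hG.hasDirDeriv_comp hO (f := fun x => (x, b x, c x)) hm
    ((hasDirDeriv_id y a).prodMk (hb.prodMk hc))
  convert h1 using 1
  -- The total derivative is split over the three slots; in the last two the metric is linear, so
  -- the difference quotients are constant for t ≠ 0.
  have e1 : ((a, b', c') : E × E × E) = (a, 0, 0) + (0, b', 0) + (0, 0, c') := by simp
  rw [e1, hG.dirDeriv_add hO hm, hG.dirDeriv_add hO hm, g.dOne_eq he hy]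
  congr 1
  · congr 1
    refine (HasDirDeriv.dirDeriv_eq (tendsto_const_nhds.congr' ?_)).symm
    filter_upwards [self_mem_nhdsWithin] with t ht
    have ht : t ≠ 0 := ht
    simp [g.localRep_add_left he hy, g.localRep_smul_left he hy, inv_mul_cancel_left₀ ht]
  · refine (HasDirDeriv.dirDeriv_eq (tendsto_const_nhds.congr' ?_)).symm
    filter_upwards [self_mem_nhdsWithin] with t ht
    have ht : t ≠ 0 := ht
    simp [g.localRep_add_right he hy, g.localRep_smul_right he hy, inv_mul_cancel_left₀ ht]

theorem dOne_add_dir {e : OpenPartialHomeomorph M E} (he : e ∈ atlas E M) {y : E}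
    (hy : y ∈ e.target) (a a' v w : E) :
    g.dOne e y (a + a') v w = g.dOne e y a v w + g.dOne e y a' v w :=
  (g.smooth_localRep_const he v w).dirDeriv_add e.open_target hy a a'

theorem dOne_smul_dir {e : OpenPartialHomeomorph M E} (he : e ∈ atlas E M) {y : E}
    (hy : y ∈ e.target) (r : ℝ) (a v w : E) :
    g.dOne e y (r • a) v w = r * g.dOne e y a v w :=
  (g.smooth_localRep_const he v w).dirDeriv_smul hy r a

theorem hasDirDeriv_dOne {e : OpenPartialHomeomorph M E} (he : e ∈ atlas E M) {y : E}
    (hy : y ∈ e.target) (a v w : E) :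
    HasDirDeriv (fun x => g.localRep e x v w) y a (g.dOne e y a v w) :=
  (g.smooth_localRep_const he v w).hasDirDeriv hy a

theorem dOne_add_left {e : OpenPartialHomeomorph M E} (he : e ∈ atlas E M) {y : E}
    (hy : y ∈ e.target) (a v v' w : E) :
    g.dOne e y a (v + v') w = g.dOne e y a v w + g.dOne e y a v' w := by
  refine (((g.hasDirDeriv_dOne he hy a v w).add (g.hasDirDeriv_dOne he hy a v' w)).congr ?_
    ).dirDeriv_eq
  exact mem_of_superset (e.open_target.mem_nhds hy) fun x hx =>
    (g.localRep_add_left he hx v v' w).symm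

theorem dOne_smul_left {e : OpenPartialHomeomorph M E} (he : e ∈ atlas E M) {y : E}
    (hy : y ∈ e.target) (a : E) (r : ℝ) (v w : E) :
    g.dOne e y a (r • v) w = r * g.dOne e y a v w := by
  refine (((g.hasDirDeriv_dOne he hy a v w).const_smul r).congr ?_).dirDeriv_eq
  exact mem_of_superset (e.open_target.mem_nhds hy) fun x hx =>
    (g.localRep_smul_left he hx r v w).symm

theorem continuous_dOne {e : OpenPartialHomeomorph M E} (he : e ∈ atlas E M) {y : E}
    (hy : y ∈ e.target) : Continuous fun z : E × E × E => g.dOne e y z.1 z.2.1 z.2.2 := by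
  simp only [g.dOne_eq he hy]
  have h := (g.smooth_localRep he).dirDeriv 0
  exact ContinuousOn.comp_continuous (f := fun z : E × E × E => ((y, z.2), (z.1, (0 : E × E))))
    h (by fun_prop) (fun z => ⟨⟨hy, trivial⟩, trivial⟩)

theorem derivAlong_val {e : OpenPartialHomeomorph M E} (he : e ∈ atlas E M) {U : Opens M}
    (X : ∀ p : M, TVec E p) {Y Z : ∀ p : M, TVec E p} (hY : IsSmoothVF U Y)
    (hZ : IsSmoothVF U Z) {p : M} (hpU : p ∈ U) (hpe : p ∈ e.source) :
    derivAlong X (fun q => g.val q (Y q) (Z q)) p =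
      g.dOne e (e p) (_root_.localRep e X (e p)) (_root_.localRep e Y (e p))
          (_root_.localRep e Z (e p)) +
        g.localRep e (e p) (dirDeriv (_root_.localRep e Y) (e p) (_root_.localRep e X (e p)))
          (_root_.localRep e Z (e p)) +
        g.localRep e (e p) (_root_.localRep e Y (e p))
          (dirDeriv (_root_.localRep e Z) (e p) (_root_.localRep e X (e p))) := by
  have hO := isOpen_chartImage e U
  have hev : EqOn (fun y => g.localRep e y (_root_.localRep e Y y) (_root_.localRep e Z y))
      (fun y => g.val (e.symm y) (Y (e.symm y)) (Z (e.symm y))) (chartImage e U) := fun y hy => by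
    have := g.val_eq_localRep he (e.map_target hy.1) Y Z
    rw [e.right_inv hy.1] at this
    exact this.symm
  have hs : BastianiSmoothOn (fun y => g.val (e.symm y) (Y (e.symm y)) (Z (e.symm y)))
      (chartImage e U) :=
    ((g.smooth_localRep he).comp
      (f := fun y => (y, _root_.localRep e Y y, _root_.localRep e Z y))
      (((ContinuousLinearMap.id ℝ E).bastianiSmoothOn _).prodMk ((hY e he).prodMk (hZ e he) hO) hO)
      (e.open_target.prod isOpen_univ) hO (fun y hy => ⟨hy.1, trivial⟩)).congr hO hev
  have hm := mem_chartImage hpe hpU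
  rw [derivAlong_eq he hs X hpU hpe]
  refine HasDirDeriv.dirDeriv_eq (HasDirDeriv.congr ?_ (mem_of_superset (hO.mem_nhds hm) hev))
  exact g.hasDirDeriv_localRep he hm.1 ((hY e he).hasDirDeriv hm _) ((hZ e he).hasDirDeriv hm _)

/-- The Koszul formula in a chart. -/
theorem koszul {D : CovDeriv E M} (hT : D.IsTorsionFree) (hC : g.IsCompatible D)
    {e : OpenPartialHomeomorph M E} (he : e ∈ atlas E M) {U : Opens M} (hU : U ≤ chartOpens e)
    {X Y : ∀ p : M, TVec E p} (hX : IsSmoothVF U X) (hY : IsSmoothVF U Y) {p : M} (hp : p ∈ U)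
    {a b : E} (ha : _root_.localRep e X (e p) = a) (hb : _root_.localRep e Y (e p) = b) (z : E) :
    2 * g.localRep e (e p) (_root_.localRep e (D.nabla U X Y) (e p)) z =
      g.dOne e (e p) a b z + g.dOne e (e p) b a z - g.dOne e (e p) z a b +
        2 * g.localRep e (e p) (dirDeriv (_root_.localRep e Y) (e p) a) z := by
  have hpe : p ∈ e.source := hU hp
  have hy := e.map_source hpe
  -- Extending z with constant coordinates makes all derivatives of Z vanish. X and Y stay general,
  -- since fields that are constant in another chart occur later.
  set Z : ∀ p : M, TVec E p := constVF e z with hZdef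
  have hZ : IsSmoothVF U Z := isSmoothVF_constVF he hU z
  have hz : _root_.localRep e Z (e p) = z := localRep_constVF_self he z hy
  have hdz : ∀ k, dirDeriv (_root_.localRep e Z) (e p) k = 0 := fun k =>
    dirDeriv_localRep_constVF he z hy k
  have hzero : ∀ v, g.localRep e (e p) 0 v = 0 := fun v => by
    simpa using g.localRep_smul_left he hy 0 0 v
  have hzero' : ∀ v, g.localRep e (e p) v 0 = 0 := fun v => by
    rw [g.localRep_symm, hzero]
  -- the three instances of compatibility
  have c1 := hC U X Y Z hX hY hZ p hp
  have c2 := hC U Y X Z hY hX hZ p hp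
  have c3 := hC U Z X Y hZ hX hY p hp
  rw [g.derivAlong_val he X hY hZ hp hpe] at c1
  rw [g.derivAlong_val he Y hX hZ hp hpe] at c2
  rw [g.derivAlong_val he Z hX hY hp hpe] at c3
  have bracket : ∀ A B : ∀ p : M, TVec E p, IsSmoothVF U A → IsSmoothVF U B →
      _root_.localRep e (D.nabla U A B) (e p) = _root_.localRep e (D.nabla U B A) (e p) +
        (dirDeriv (_root_.localRep e B) (e p) (_root_.localRep e A (e p)) +
        -dirDeriv (_root_.localRep e A) (e p) (_root_.localRep e B (e p))) := by
    intro A B hA hB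
    have h1 : D.nabla U A B p = D.nabla U B A p + lieBracketVF A B p :=
      eq_add_of_sub_eq' (hT U A B hA hB p hp)
    rw [← sub_eq_add_neg, ← localRep_lieBracketVF he hA hB hp hpe, _root_.localRep_apply hpe,
      _root_.localRep_apply hpe, _root_.localRep_apply hpe, h1]
    exact tangentChange_add (chart_mem_atlas E p) he (mem_chart_source E p) hpe _ _
  -- Torsion-freeness trades ∇_X Z and ∇_Y Z for ∇_Z X and ∇_Z Y, which then cancel in c1 + c2 - c3,
  -- and relates ∇_Y X to ∇_X Y.
  have t1 := bracket X Y hX hY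
  have t2 := bracket X Z hX hZ
  have t3 := bracket Y Z hY hZ
  simp only [g.val_eq_localRep he hpe] at c1 c2 c3
  rw [ha, hb] at t1
  rw [ha, hz, hdz] at t2
  rw [hb, hz, hdz] at t3
  rw [t2] at c1
  rw [t3] at c2
  rw [ha, hb, hz, hdz] at c1 c2
  rw [ha, hb, hz] at c3
  have u1 := congrArg (fun v => g.localRep e (e p) v z) t1
  simp only [g.localRep_add_left he hy, g.localRep_add_right he hy, g.localRep_neg_left he hy,
    g.localRep_neg_right he hy, hzero'] at c1 c2 c3 u1
  have s1 := g.localRep_symm e (e p) a (_root_.localRep e (D.nabla U Z Y) (e p))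
  have s2 := g.localRep_symm e (e p) b (_root_.localRep e (D.nabla U Z X) (e p))
  have s3 := g.localRep_symm e (e p) b (dirDeriv (_root_.localRep e X) (e p) z)
  have s4 := g.localRep_symm e (e p) a (dirDeriv (_root_.localRep e Y) (e p) z)
  linarith

end WeakRiemannianMetric

end Koszul

/-! ### Baire category and closed graphs in Fréchet spaces. -/

section Frechet

variable {E : Type u} [AddCommGroup E] [Module ℝ E] [TopologicalSpace E]
  [IsTopologicalAddGroup E] [ContinuousSMul ℝ E]

theorem IsFrechetSpace.baireSpace (hE : IsFrechetSpace E) : BaireSpace E := by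
  obtain ⟨hE1, hE2⟩ := hE
  let _ := IsTopologicalAddGroup.rightUniformSpace E
  have : IsUniformAddGroup E := isUniformAddGroup_of_addCommGroup
  have : (uniformity E).IsCountablyGenerated := IsUniformAddGroup.uniformity_countably_generated
  infer_instance

/-- The closed graph theorem for Fréchet spaces. -/
theorem IsFrechetSpace.continuous_of_tendsto_unique (hE : IsFrechetSpace E) (T : E →ₗ[ℝ] E)
    (hT : ∀ (r : ℕ → E) (x y : E), Tendsto r atTop (𝓝 x) →
      Tendsto (fun n => T (r n)) atTop (𝓝 y) → y = T x) : Continuous T := by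
  have := hE.baireSpace
  obtain ⟨hE1, hE2⟩ := hE
  let _ := IsTopologicalAddGroup.rightUniformSpace E
  have : IsUniformAddGroup E := isUniformAddGroup_of_addCommGroup
  exact LinearMap.continuous_of_tendsto_unique T hT

end Frechet

/-! ### Christoffel symbols of the metric derivative and the metric spray. -/

section MetricSpray

variable {E : Type u} [AddCommGroup E] [Module ℝ E] [TopologicalSpace E]
  [IsTopologicalAddGroup E] [ContinuousSMul ℝ E] [LocallyConvexSpace ℝ E] [T2Space E]
  {M : Type w} [TopologicalSpace M] [ChartedSpace E M] [BastianiManifold E M]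

theorem chartImage_chartOpens (e : OpenPartialHomeomorph M E) :
    chartImage e (chartOpens e) = e.target :=
  inter_eq_left.2 fun _ hy => e.map_target hy

/-- The local representative `(y, v, w) ↦ (∇_v w)(y)` of a covariant derivative on vector fields
that are constant in the chart `e`. -/
noncomputable def CovDeriv.christoffel (D : CovDeriv E M) (e : OpenPartialHomeomorph M E)
    (y v w : E) : E :=
  localRep e (D.nabla (chartOpens e) (constVF e v) (constVF e w)) y

theorem CovDeriv.smooth_christoffel (D : CovDeriv E M) {e : OpenPartialHomeomorph M E}
    (he : e ∈ atlas E M) (v w : E) :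
    BastianiSmoothOn (fun y => D.christoffel e y v w) e.target := by
  have h := D.smooth _ _ _ (isSmoothVF_constVF he le_rfl v) (isSmoothVF_constVF he le_rfl w) e he
  rwa [chartImage_chartOpens] at h

section LeviCivita

variable {g : WeakRiemannianMetric E M} {D : CovDeriv E M} (hT : D.IsTorsionFree)
  (hC : g.IsCompatible D) {e : OpenPartialHomeomorph M E} (he : e ∈ atlas E M)

include hT hC he

/-- For `v = w` and after a change of sign, this is the equation of a metric spray. -/
theorem CovDeriv.christoffel_koszul {y : E} (hy : y ∈ e.target) (v w z : E) :
    2 * g.localRep e y (D.christoffel e y v w) z =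
      g.dOne e y v w z + g.dOne e y w v z - g.dOne e y z v w := by
  have hp := e.map_target hy
  have key := g.koszul hT hC he le_rfl (isSmoothVF_constVF he le_rfl v)
    (isSmoothVF_constVF he le_rfl w) (p := e.symm y) hp (a := v) (b := w)
    (localRep_constVF_self he v (e.map_source hp)) (localRep_constVF_self he w (e.map_source hp)) z
  rw [e.right_inv hy, dirDeriv_localRep_constVF he w hy] at key
  have h0 : g.localRep e y 0 z = 0 := by simpa using g.localRep_smul_left he hy 0 0 z
  rw [h0, mul_zero, add_zero] at key
  exact key

/-- This and the linearity below are inherited from the right side of the Koszul formula through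
definiteness of g. -/
theorem CovDeriv.christoffel_symm {y : E} (hy : y ∈ e.target) (v w : E) :
    D.christoffel e y v w = D.christoffel e y w v := by
  refine g.eq_of_localRep_eq he hy fun z => ?_
  have h1 := CovDeriv.christoffel_koszul hT hC he hy v w z
  have h2 := CovDeriv.christoffel_koszul hT hC he hy w v z
  have h3 := g.dOne_symm e y z v w
  linarith

theorem CovDeriv.christoffel_add_left {y : E} (hy : y ∈ e.target) (v v' w : E) :
    D.christoffel e y (v + v') w = D.christoffel e y v w + D.christoffel e y v' w := by
  refine g.eq_of_localRep_eq he hy fun z => ?_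
  have h1 := CovDeriv.christoffel_koszul hT hC he hy (v + v') w z
  have h2 := CovDeriv.christoffel_koszul hT hC he hy v w z
  have h3 := CovDeriv.christoffel_koszul hT hC he hy v' w z
  rw [g.dOne_add_dir he hy, g.dOne_add_left he hy, g.dOne_add_left he hy] at h1
  rw [g.localRep_add_left he hy]
  linarith

theorem CovDeriv.christoffel_smul_left {y : E} (hy : y ∈ e.target) (r : ℝ) (v w : E) :
    D.christoffel e y (r • v) w = r • D.christoffel e y v w := by
  refine g.eq_of_localRep_eq he hy fun z => ?_
  have h1 := CovDeriv.christoffel_koszul hT hC he hy (r • v) w z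
  have h2 := CovDeriv.christoffel_koszul hT hC he hy v w z
  rw [g.dOne_smul_dir he hy, g.dOne_smul_left he hy, g.dOne_smul_left he hy] at h1
  rw [g.localRep_smul_left he hy]
  linear_combination (h1 - r * h2) / 2

theorem CovDeriv.christoffel_smul_smul {y : E} (hy : y ∈ e.target) (r : ℝ) (v : E) :
    D.christoffel e y (r • v) (r • v) = r • r • D.christoffel e y v v := by
  rw [CovDeriv.christoffel_smul_left hT hC he hy, CovDeriv.christoffel_symm hT hC he hy,
    CovDeriv.christoffel_smul_left hT hC he hy]

/-- The graph is closed because, paired with any z, the symbol becomes the Koszul expression, which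
is continuous in v; g(·, z) is continuous too and the pairings separate points. -/
theorem CovDeriv.eq_christoffel_of_tendsto {y : E} (hy : y ∈ e.target) {w x b : E} {r : ℕ → E}
    (hr : Tendsto r atTop (𝓝 x))
    (hb : Tendsto (fun n => D.christoffel e y (r n) w) atTop (𝓝 b)) :
    b = D.christoffel e y x w := by
  refine g.eq_of_localRep_eq he hy fun z => ?_
  have hg : Continuous fun v => 2 * g.localRep e y v z :=
    continuous_const.mul (g.continuous_localRep he hy z)
  have hd := g.continuous_dOne he hy
  have c1 : Continuous fun v => g.dOne e y v w z :=
    hd.comp (f := fun v : E => (v, w, z)) (by fun_prop)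
  have c2 : Continuous fun v => g.dOne e y w v z :=
    hd.comp (f := fun v : E => (w, v, z)) (by fun_prop)
  have c3 : Continuous fun v => g.dOne e y z v w :=
    hd.comp (f := fun v : E => (z, v, w)) (by fun_prop)
  have h1 : Tendsto (fun n => 2 * g.localRep e y (D.christoffel e y (r n) w) z) atTop
      (𝓝 (2 * g.localRep e y b z)) := (hg.tendsto b).comp hb
  have h2 : Tendsto (fun n => 2 * g.localRep e y (D.christoffel e y (r n) w) z) atTop
      (𝓝 (2 * g.localRep e y (D.christoffel e y x w) z)) := by
    simp only [CovDeriv.christoffel_koszul hT hC he hy]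
    exact (((c1.add c2).sub c3).tendsto x).comp hr
  exact mul_left_cancel₀ two_ne_zero (tendsto_nhds_unique h1 h2)

/-- On a Fréchet space, the Christoffel symbols are continuous in each argument. -/
theorem CovDeriv.exists_clm_christoffel (hE : IsFrechetSpace E) {y : E} (hy : y ∈ e.target)
    (w : E) : ∃ L : E →L[ℝ] E, ∀ v, D.christoffel e y v w = L v := by
  let T : E →ₗ[ℝ] E :=
    { toFun := fun v => D.christoffel e y v w
      map_add' := fun v v' => CovDeriv.christoffel_add_left hT hC he hy v v' w
      map_smul' := fun r v => CovDeriv.christoffel_smul_left hT hC he hy r v w }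
  have hTc : Continuous T := by
    refine hE.continuous_of_tendsto_unique T fun r x b hr hb => ?_
    exact CovDeriv.eq_christoffel_of_tendsto hT hC he hy hr hb
  exact ⟨⟨T, hTc⟩, fun v => rfl⟩

/-- The quadratic form of the Levi-Civita derivative is smooth. -/
theorem CovDeriv.smooth_christoffel_diag
    (hF : IsFrechetSpace E ∨ D.PreservesSmoothFamilies) :
    BastianiSmoothOn (fun z : E × E => D.christoffel e z.1 z.2 z.2) (e.target ×ˢ univ) := by
  have hO := e.open_target.prod (isOpen_univ (X := E))
  rcases hF with hE | hP
  · have := hE.1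
    have := hE.baireSpace
    -- The arguments are made variable one at a time: first v with parameter y, then w with
    -- parameter (y, v).
    have s1 : ∀ w, BastianiSmoothOn (fun z : E × E => D.christoffel e z.1 z.2 w)
        (e.target ×ˢ univ) := fun w =>
      bastianiSmoothOn_of_separately e.open_target (fun v => D.smooth_christoffel he v w)
        (fun y hy => CovDeriv.exists_clm_christoffel hT hC he hE hy w)
    have s2 : BastianiSmoothOn (fun z : (E × E) × E => D.christoffel e z.1.1 z.1.2 z.2)
        ((e.target ×ˢ univ) ×ˢ univ) :=
      bastianiSmoothOn_of_separately hO s1 (fun z hz => by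
        obtain ⟨L, hL⟩ := CovDeriv.exists_clm_christoffel hT hC he hE hz.1 z.2
        exact ⟨L, fun v => (CovDeriv.christoffel_symm hT hC he hz.1 z.2 v).trans (hL v)⟩)
    exact s2.comp_clm ((ContinuousLinearMap.id ℝ (E × E)).prod (ContinuousLinearMap.snd ℝ E E)) hO
      (fun z hz => ⟨hz, trivial⟩)
  -- A smooth family has one parameter, shared by both arguments of ∇; this yields exactly the
  -- diagonal.
  · have hs := isSmoothFamily_constVF he (le_refl (chartOpens e))
    have h := hP _ _ _ hs hs e he
    rw [chartImage_chartOpens] at h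
    exact h.comp_clm ((ContinuousLinearMap.snd ℝ E E).prod (ContinuousLinearMap.fst ℝ E E)) hO
      (fun z hz => ⟨trivial, hz.1⟩)

end LeviCivita

/-- The spray of a covariant derivative. -/
noncomputable def CovDeriv.sprayFun (D : CovDeriv E M) (p : M) (v : TVec E p) : E × E :=
  (v, -D.christoffel (chartAt E p) (chartAt E p p) v v)

/-- The local representative of the spray of the Levi-Civita derivative. -/
theorem CovDeriv.sprayFun_localRep {g : WeakRiemannianMetric E M} {D : CovDeriv E M}
    (hT : D.IsTorsionFree) (hC : g.IsCompatible D) {e : OpenPartialHomeomorph M E}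
    (he : e ∈ atlas E M) {y : E} (hy : y ∈ e.target) (v : E) :
    dirDeriv (tangentFun fun z => e ((chartAt E (e.symm y)).symm z))
      (chartAt E (e.symm y) (e.symm y), tvec e y v) (D.sprayFun (e.symm y) (tvec e y v)) =
      (v, -D.christoffel e y v v) := by
  rw [tvec_eq_constVF hy]
  have hpe : e.symm y ∈ e.source := e.map_target hy
  have hey : e (e.symm y) = y := e.right_inv hy
  generalize e.symm y = p at hpe hey ⊢
  have hf := chart_mem_atlas E p
  have hpf := mem_chart_source E p
  set f := chartAt E p with hfdef
  have hw : constVF e v p = tangentChange e f p v := rfl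
  set w : E := tangentChange e f p v with hwdef
  rw [hw]
  let U : Opens M := chartOpens e ⊓ chartOpens f
  have hpU : p ∈ U := ⟨hpe, hpf⟩
  have hX : IsSmoothVF U (constVF e v) := isSmoothVF_constVF he inf_le_left v
  have hXf : localRep f (constVF e v) (f p) = w := localRep_constVF_apply he hf hpe hpf v
  have hτ := transition_smooth hf he
  have hm := mem_transition hpf hpe
  have hy' : f p ∈ f.target := f.map_source hpf
  set d : E := dirDeriv (localRep f (constVF e v)) (f p) w with hd
  -- the covariant derivative of the field that is constant in `e`, in the chart `f`
  have h1 : localRep f (D.nabla U (constVF e v) (constVF e v)) (f p) =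
      D.christoffel f (f p) w w + d := by
    refine g.eq_of_localRep_eq hf hy' fun z => ?_
    have k1 := g.koszul hT hC hf (U := U) inf_le_right hX hX hpU hXf hXf z
    have k2 := CovDeriv.christoffel_koszul hT hC hf hy' w w z
    rw [g.localRep_add_left hf hy']
    linarith
  -- The same vector ∇_X X at p, for the field X that is constant in `e`, is read in the chart `e`;
  -- compatibility with restriction passes from `U` to the domain of `e`.
  have h2 : tangentChange f e p (D.christoffel f (f p) w w + d) = D.christoffel e y v v := by
    rw [← h1, ← localRep_change hf he hpf hpe, CovDeriv.christoffel, ← hey,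
      localRep_apply hpe, localRep_apply hpe]
    congr 1
    exact D.restrict (chartOpens e) U inf_le_left _ _ _ _ (isSmoothVF_constVF he le_rfl v)
      (isSmoothVF_constVF he le_rfl v) (fun _ _ => rfl) (fun _ _ => rfl) p hpU
  -- As X is constant in `e`, the left side vanishes. With τ = e ∘ f⁻¹, this gives d²τ(w, w) =
  -- -dτ(d), so d²τ(w, w) - dτ(C_f(w, w)) = -dτ(C_f(w, w) + d) = -C_e(v, v) by `h2`.
  have h3 := dirDeriv_localRep_change hf he hX hpU hpf hpe w
  rw [dirDeriv_localRep_constVF he v (e.map_source hpe), hXf] at h3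
  have hdir : HasDirDeriv (tangentFun fun z => e (f.symm z)) (f p, w)
      (D.sprayFun p w) (v, -D.christoffel e y v v) := by
    refine HasDirDeriv.prodMk (f := fun z : E × E => e (f.symm z.1))
      (g := fun z : E × E => dirDeriv (fun z => e (f.symm z)) z.1 z.2) ?_ ?_
    · have h4 := hasDirDeriv_transition hf he hpf hpe w
      rw [hwdef, tangentChange_inv he hf hpe hpf] at h4
      exact HasDirDeriv.comp_clm (f := fun z => e (f.symm z)) (ContinuousLinearMap.fst ℝ E E) h4
    · have h5 := hτ.dirDeriv.hasDirDeriv (x := (f p, w)) ⟨hm, trivial⟩ (D.sprayFun p w)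
      convert h5 using 1
      rw [CovDeriv.sprayFun, hτ.dirDeriv_fst_snd (isOpen_transition f e) hm, ← h2]
      change _ = _ + tangentChange f e p _
      rw [tangentChange_add hf he hpf hpe, tangentChange_neg hf he hpf hpe]
      rw [eq_neg_of_add_eq_zero_left h3.symm]
      abel
  exact hdir.dirDeriv_eq

theorem WeakRiemannianMetric.HasMetricDerivative.isHesse {g : WeakRiemannianMetric E M}
    (hg : g.HasMetricDerivative) : g.IsHesse := by
  obtain ⟨D, hT, hC, hF⟩ := hg
  let S : Spray E M :=
    { toFun := D.sprayFun
      smooth := fun e he => by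
        have hO := e.open_target.prod (isOpen_univ (X := E))
        refine (((ContinuousLinearMap.snd ℝ E E).bastianiSmoothOn _).prodMk
          ((CovDeriv.smooth_christoffel_diag hT hC he hF).clm_comp
            (-ContinuousLinearMap.id ℝ E) hO) hO).congr hO ?_
        rintro ⟨y, v⟩ ⟨hy, -⟩
        exact (CovDeriv.sprayFun_localRep hT hC he hy v).symm
      proj := fun p v => rfl
      homogeneous := fun c p v => by
        have h := CovDeriv.christoffel_smul_smul hT hC (chart_mem_atlas E p)
          ((chartAt E p).map_source (mem_chart_source E p)) c v
        simp only [CovDeriv.sprayFun, h, Prod.smul_mk, smul_neg] }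
  refine ⟨S, fun e he y hy v w => ?_⟩
  have hq : S.quadForm e y v = -D.christoffel e y v v :=
    congrArg Prod.snd (CovDeriv.sprayFun_localRep hT hC he hy v)
  have hk := CovDeriv.christoffel_koszul hT hC he hy v v w
  rw [hq, g.localRep_neg_left he hy]
  simp only [WeakRiemannianMetric.dOne] at hk
  linarith

end MetricSpray

theorem mainTheorem5 {E : Type u} [AddCommGroup E] [Module ℝ E] [TopologicalSpace E]
    [IsTopologicalAddGroup E] [ContinuousSMul ℝ E] [LocallyConvexSpace ℝ E] [T2Space E]
    {M : Type w} [TopologicalSpace M] [ChartedSpace E M] [BastianiManifold E M]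
    (g : WeakRiemannianMetric E M) (hg : g.IsRobust) : g.IsHesse :=
  hg.2.isHesse
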